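/- Let $\kappa\in\mathbb{R}$, let $(X,\rho)$ be a $\mathrm{CAT}(\kappa)$ space, and put $D_\kappa=\infty$ if $\kappa\le 0$ and $D_\kappa=\pi/\sqrt{\kappa}$ if $\kappa>0$. Let $C\subset X$ be a bounded closed set with more than one point. Let $x\in C$ be such that $\rho(z,x)<D_\kappa/2$ for every $z\in C$, and such that for every $z\in C$ the metric segment $[z,x]$ joining $z$ to $x$ is contained in $C$. Let $\mathcal{M}$ be the space of all nonexpansive mappings $f\colon C\to C$ (that is, $\rho(f(y),f(z))\le\rho(y,z)$ for all $y,z\in C$), with the metric $d_\infty(f,g)=\sup_{y\in C}\rho(f(y),g(y))$. For $f\in\mathcal{M}$ and $y\in C$ let $$\operatorname{lip}(f,y)=\limsup_{r\searrow 0}\ \sup\left\{\frac{\rho(f(z),f(y))}{\rho(z,y)} : z\in C,\ 0<\rho(z,y)<r\right\}.$$ Then there is a $\sigma$-porous set $\mathcal{P}\subset\mathcal{M}$ such that for every $f\in\mathcal{M}\setminus\mathcal{P}$ the set $R(f)=\{y\in C : \operatorname{lip}(f,y)=1\}$ is residual in $C$, i.e. its complement in $C$ is of the first Baire category in $C$.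 Here a subset $A$ of a metric space $M$ is called porous if for every $a\in A$ there are $\varepsilon_0>0$ and $\alpha>0$ such that for every $\varepsilon\in(0,\varepsilon_0)$ there is $b\in B(a,\varepsilon)$ with $B(b,\alpha\varepsilon)\cap A=\emptyset$ (open balls), and $\sigma$-porous if it is a countable union of porous sets. $X$ is $\mathrm{CAT}(\kappa)$ if any two points at distance less than $D_\kappa$ are joined by a metric segment and every geodesic triangle of perimeter less than $2D_\kappa$ is at least as thin as a comparison triangle in the model surface $M_\kappa$ of constant curvature $\kappa$ (a scaled sphere, the Euclidean plane, or a scaled hyperbolic plane). -/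

import Mathlib

open Set Filter Topology Metric
open scoped ENNReal

/-! ### Metric segments and geodesic triangles -/

/-- `S` is a metric segment joining `a` to `b`, for the distance function `d` on `M`: the image of
an isometric embedding `c : [0, d a b] → M` with `c 0 = a` and `c (d a b) = b`. -/
def IsMetricSegment {M : Type*} (d : M → M → ℝ) (a b : M) (S : Set M) : Prop :=
  ∃ c : ℝ → M, c 0 = a ∧ c (d a b) = b ∧
    (∀ s ∈ Icc 0 (d a b), ∀ t ∈ Icc 0 (d a b), d (c s) (c t) = |s - t|) ∧
    c '' Icc 0 (d a b) = S

/-- A geodesic triangle: three vertices, and for each `i : Fin 3` (cyclically) a metric segment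
`side i` joining `vertex i` to `vertex (i + 1)`. -/
structure GeodesicTriangle {M : Type*} (d : M → M → ℝ) where
  /-- the vertices -/
  vertex : Fin 3 → M
  /-- the sides -/
  side : Fin 3 → Set M
  isMetricSegment_side : ∀ i, IsMetricSegment d (vertex i) (vertex (i + 1)) (side i)

/-- `T'` is a comparison triangle for `T`. -/
def IsComparisonTriangle {X M : Type*} {ρ : X → X → ℝ} {d : M → M → ℝ}
    (T : GeodesicTriangle ρ) (T' : GeodesicTriangle d) : Prop :=
  ∀ i j, d (T'.vertex i) (T'.vertex j) = ρ (T.vertex i) (T.vertex j)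

/-- `p'`, on the `i`-th side of `T'`, is a comparison point for `p`, on the `i`-th side of `T`. -/
def IsComparisonPoint {X M : Type*} {ρ : X → X → ℝ} {d : M → M → ℝ}
    (T : GeodesicTriangle ρ) (T' : GeodesicTriangle d) (i : Fin 3) (p : X) (p' : M) : Prop :=
  p ∈ T.side i ∧ p' ∈ T'.side i ∧
    d p' (T'.vertex i) = ρ p (T.vertex i) ∧
    d p' (T'.vertex (i + 1)) = ρ p (T.vertex (i + 1))

/-- The triangle `T` is at least as thin as some comparison triangle in `(M, d)`. -/
def IsThinTriangle {X M : Type*} {ρ : X → X → ℝ} (T : GeodesicTriangle ρ) (d : M → M → ℝ) :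
    Prop :=
  ∃ T' : GeodesicTriangle d, IsComparisonTriangle T T' ∧
    ∀ (i j : Fin 3) (p q : X) (p' q' : M),
      IsComparisonPoint T T' i p p' → IsComparisonPoint T T' j q q' → ρ p q ≤ d p' q'

/-! ### Model spaces and `CAT(κ)` spaces -/

/-- The model space `M_κ` with its distance function: for `κ > 0` the unit sphere of Euclidean
three-space with its intrinsic (angular) metric scaled by `1 / √κ`, for `κ = 0` the Euclidean
plane, and for `κ < 0` the hyperbolic plane (of curvature `-1`, in the upper half-plane model) with
its metric scaled by `1 / √(-κ)`. -/
noncomputable def modelSpace (κ : ℝ) : (M : Type) × (M → M → ℝ) :=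
  open scoped Classical in
  if 0 < κ then
    ⟨sphere (0 : EuclideanSpace ℝ (Fin 3)) 1,
      fun u v => (1 / √κ) * InnerProductGeometry.angle (u : EuclideanSpace ℝ (Fin 3)) v⟩
  else if κ = 0 then
    ⟨EuclideanSpace ℝ (Fin 2), fun u v => dist u v⟩
  else
    ⟨UpperHalfPlane, fun u v => (1 / √(-κ)) * dist u v⟩

/-- The constant `D_κ`: it is `π / √κ` for `κ > 0` and `∞` for `κ ≤ 0`. -/
noncomputable def modelDiam (κ : ℝ) : ℝ≥0∞ :=
  open scoped Classical in
  if 0 < κ then ENNReal.ofReal (Real.pi / √κ) else ⊤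

/-- `X` is a `CAT(κ)` space: points at distance less than `D_κ` are joined by a metric segment, and
every geodesic triangle of perimeter less than `2 D_κ` is at least as thin as its comparison
triangle in `M_κ`. For `κ ≤ 0` both bounds are `∞`, hence void. -/
structure IsCATSpace (κ : ℝ) (X : Type*) [MetricSpace X] : Prop where
  exists_segment : ∀ a b : X, edist a b < modelDiam κ → ∃ S, IsMetricSegment dist a b S
  thin : ∀ T : GeodesicTriangle (dist : X → X → ℝ),
    edist (T.vertex 0) (T.vertex 1) + edist (T.vertex 1) (T.vertex 2)
      + edist (T.vertex 2) (T.vertex 0) < 2 * modelDiam κ →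
    IsThinTriangle T (modelSpace κ).2

/-! ### Porosity -/

/-- `A` is porous at the point `a`. -/
def IsPorousAt {M : Type*} [PseudoMetricSpace M] (A : Set M) (a : M) : Prop :=
  ∃ ε₀ > 0, ∃ α > 0, ∀ ε : ℝ, 0 < ε → ε < ε₀ →
    ∃ b ∈ ball a ε, ball b (α * ε) ∩ A = ∅

/-- `A` is porous: porous at each of its points. -/
def IsPorous {M : Type*} [PseudoMetricSpace M] (A : Set M) : Prop :=
  ∀ a ∈ A, IsPorousAt A a

/-- `A` is σ-porous: a countable union of porous sets. -/
def IsSigmaPorous {M : Type*} [PseudoMetricSpace M] (A : Set M) : Prop :=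
  ∃ S : ℕ → Set M, (∀ n, IsPorous (S n)) ∧ A = ⋃ n, S n

/-! ### Nonexpansive mappings and their local Lipschitz constants -/

/-- The space of nonexpansive self-mappings of `C`, with the supremum metric
`d_∞ (f, g) = sup {ρ (f y, g y) : y ∈ C}`, inherited from Mathlib's space of bounded continuous
functions. When `C` is bounded, every nonexpansive mapping `C → C` is a bounded continuous
function, so that these are all of them. -/
abbrev NonexpansiveMap {X : Type*} [MetricSpace X] (C : Set X) : Type _ :=
  {f : BoundedContinuousFunction C C // LipschitzWith 1 f}

/-- The local Lipschitz constant `lip (f, y)`, the `limsup` as `r ↘ 0` of the supremum of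
`ρ (f z, f y) / ρ (z, y)` over `z ≠ y` in the open ball of radius `r` around `y`, as an extended
nonnegative real number. -/
noncomputable def localLip {Y : Type*} [MetricSpace Y] (f : Y → Y) (y : Y) : ℝ≥0∞ :=
  limsup (fun r : ℝ => ⨆ z ∈ ball y r \ {y}, edist (f z) (f y) / edist z y) (𝓝[>] 0)

/-- The set `R(f) = {y ∈ C : lip (f, y) = 1}`. -/
def lipOneSet {X : Type*} [MetricSpace X] {C : Set X} (f : NonexpansiveMap C) : Set C :=
  {y | localLip f.1 y = 1}

/-! If `f` is nonexpansive and every ball of `C` contains pairs of arbitrarily close points that `f`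
contracts by a factor as near to 1 as desired, then the points having such partners form countably
many dense open sets, and `lip (f, ·) = 1` on their intersection. Otherwise `f` is `L`-Lipschitz,
with `L < 1`, on some ball. The centre of this ball may be taken at a rational distance `q` from the
pole `x`, so countably many sets `locallyContractiveMaps x B q s L` catch all exceptional mappings,
and it remains to show that each of them is porous (`IsRadial.isPorous_locallyContractiveMaps`).

For this, `IsRadial.exists_perturbation` moves `f` by `O(t)` to a nonexpansive `g` that preserves a
distance `β t` inside each relevant ball; a mapping much closer to `g` than `β t` cannot be
`L`-Lipschitz there. To build `g`, precompose `f` with the map `ψ` that collapses a thin shell of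
radii `[q - l, q]`, with `l` proportional to `t`; then pull the values towards `x` by the factor `1
- t`; finally lower them along their rays by a height function with bumps at a separated net on the
sphere of radius `q`. On the last piece, of length `l`, of the segment from `x` to a net point, `f ∘
ψ` is constant and the height varies at unit speed, so `g` is isometric on half of that piece.

That `g` remains nonexpansive rests on a budget (`IsRadial.dist_rayPoint_le`): the collapse frees
room for a height that depends on the depth in the shell, and the pull towards `x` frees room for a
slope `e t` of the bumps.

Curvature enters only through the law of cosines in the form `S(c/2)² = S((a-b)/2)² + S(a) S(b)
sin²(θ/2)`, where `S` is the generalized sine. In a `CAT(κ)` space it survives as an inequality for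
points on two segments from `x`, which is what `IsRadial` records. -/

/-! ### Polar distance formulas in the model spaces -/

section Models

open Real InnerProductGeometry

/-- Spherical interpolation along a great circle. Expanding the squared norm of the difference of
the two sides gives zero, so degenerate positions need no separate treatment. -/
theorem sin_angle_smul_eq {V : Type*} [NormedAddCommGroup V] [InnerProductSpace ℝ V] {X A P : V}
    (hX : ‖X‖ = 1) (hA : ‖A‖ = 1) (hP : ‖P‖ = 1)
    (h : angle X P + angle P A = angle X A) :
    sin (angle X A) • P = sin (angle P A) • X + sin (angle X P) • A := by
  have cXP : inner ℝ X P = cos (angle X P) := by rw [cos_angle]; simp [hX, hP]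
  have cPA : inner ℝ P A = cos (angle P A) := by rw [cos_angle]; simp [hA, hP]
  have cXA : inner ℝ X A = cos (angle X A) := by rw [cos_angle]; simp [hX, hA]
  have h1 : ‖sin (angle X A) • P - (sin (angle P A) • X + sin (angle X P) • A)‖ ^ 2 = 0 := by
    rw [norm_sub_sq_real, norm_add_sq_real]
    simp only [norm_smul, inner_smul_left, inner_smul_right, inner_add_right, hX, hA, hP,
      real_inner_comm X P, cXP, cPA, cXA, mul_one, Real.norm_eq_abs, sq_abs]
    rw [← h, sin_add, cos_add]
    generalize angle X P = r
    generalize angle P A = s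
    simp only [conj_trivial]
    have e1 := sin_sq_add_cos_sq r
    have e2 := sin_sq_add_cos_sq s
    linear_combination (-(sin s)^2) * e1 - (sin r)^2 * e2
  exact sub_eq_zero.1 (by simpa using h1)

/-- The law of cosines for the triangles `X P Q` and `X A B`, with their common angle at `X`
eliminated. Pairing the interpolation formulas for `P` and `Q` avoids speaking of that angle and of
division by a sine. -/
theorem sin_mul_sin_mul_cos_sub {V : Type*} [NormedAddCommGroup V] [InnerProductSpace ℝ V]
    {X A B P Q : V} (hX : ‖X‖ = 1) (hA : ‖A‖ = 1) (hB : ‖B‖ = 1) (hP : ‖P‖ = 1) (hQ : ‖Q‖ = 1)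
    (h : angle X P + angle P A = angle X A) (h' : angle X Q + angle Q B = angle X B) :
    sin (angle X A) * sin (angle X B) * (cos (angle X P - angle X Q) - cos (angle P Q)) =
      sin (angle X P) * sin (angle X Q) * (cos (angle X A - angle X B) - cos (angle A B)) := by
  have cPQ : inner ℝ P Q = cos (angle P Q) := by rw [cos_angle]; simp [hP, hQ]
  have cAB : inner ℝ A B = cos (angle A B) := by rw [cos_angle]; simp [hA, hB]
  have cXA : inner ℝ A X = cos (angle X A) := by rw [real_inner_comm, cos_angle]; simp [hX, hA]
  have cXB : inner ℝ X B = cos (angle X B) := by rw [cos_angle]; simp [hX, hB]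
  have h1 : inner ℝ (sin (angle X A) • P) (sin (angle X B) • Q) =
      inner ℝ (sin (angle P A) • X + sin (angle X P) • A)
        (sin (angle Q B) • X + sin (angle X Q) • B) := by
    rw [sin_angle_smul_eq hX hA hP h, sin_angle_smul_eq hX hB hQ h']
  simp only [inner_smul_left, inner_smul_right, inner_add_right, inner_add_left, cPQ, cAB, cXA, cXB,
    real_inner_self_eq_norm_sq, hX, conj_trivial] at h1
  have l1 : sin (angle X A) * cos (angle X P) =
      sin (angle P A) + sin (angle X P) * cos (angle X A) := by
    rw [← h, sin_add, cos_add]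
    linear_combination (sin (angle P A)) * sin_sq_add_cos_sq (angle X P)
  have l2 : sin (angle X B) * cos (angle X Q) =
      sin (angle Q B) + sin (angle X Q) * cos (angle X B) := by
    rw [← h', sin_add, cos_add]
    linear_combination (sin (angle Q B)) * sin_sq_add_cos_sq (angle X Q)
  rw [cos_sub, cos_sub]
  linear_combination (sin (angle X B) * cos (angle X Q)) * l1 +
    (sin (angle P A) + sin (angle X P) * cos (angle X A)) * l2 - h1

theorem dist_smul_eq_of_dist_add_dist {V : Type*} [NormedAddCommGroup V] [InnerProductSpace ℝ V]
    {X A P : V} (h : dist X P + dist P A = dist X A) :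
    dist X A • (P - X) = dist X P • (A - X) := by
  have h1 : SameRay ℝ (P - X) (A - P) := by
    rw [sameRay_iff_norm_add]
    rw [dist_comm X P, dist_comm P A, dist_comm X A, dist_eq_norm, dist_eq_norm, dist_eq_norm] at h
    rw [h]; congr 1; abel
  have h2 := h1.norm_smul_eq
  rw [← h, dist_comm X P, dist_comm P A, dist_eq_norm, dist_eq_norm]
  have : A - X = (P - X) + (A - P) := by abel
  rw [this, smul_add, add_smul, h2]

theorem dist_mul_dist_mul_dist_sq {V : Type*} [NormedAddCommGroup V] [InnerProductSpace ℝ V]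
    {X A B P Q : V} (h : dist X P + dist P A = dist X A) (h' : dist X Q + dist Q B = dist X B) :
    dist X A * dist X B * (dist P Q ^ 2 - (dist X P - dist X Q) ^ 2) =
      dist X P * dist X Q * (dist A B ^ 2 - (dist X A - dist X B) ^ 2) := by
  have e : ∀ U W : V, dist U W ^ 2 =
      dist X U ^ 2 + dist X W ^ 2 - 2 * inner ℝ (U - X) (W - X) := by
    intro U W
    have : U - W = (U - X) - (W - X) := by abel
    rw [dist_eq_norm, this, norm_sub_sq_real, dist_comm X U, dist_comm X W, dist_eq_norm,
      dist_eq_norm]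
    ring
  have h1 : inner ℝ (dist X A • (P - X)) (dist X B • (Q - X)) =
      inner ℝ (dist X P • (A - X)) (dist X Q • (B - X)) := by
    rw [dist_smul_eq_of_dist_add_dist h, dist_smul_eq_of_dist_add_dist h']
  simp only [inner_smul_left, inner_smul_right, conj_trivial] at h1
  rw [e P Q, e A B]
  linear_combination (-2) * h1

namespace UpperHalfPlane

/-- The coordinates of a point of the upper half-plane on the hyperboloid. -/
noncomputable def hyperboloid (z : UpperHalfPlane) : Fin 3 → ℝ :=
  ![(z.re ^ 2 + z.im ^ 2 + 1) / (2 * z.im), (z.re ^ 2 + z.im ^ 2 - 1) / (2 * z.im), z.re / z.im]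

/-- The Lorentz form, positive on timelike vectors. -/
def lorentz (u v : Fin 3 → ℝ) : ℝ := u 0 * v 0 - u 1 * v 1 - u 2 * v 2

theorem cosh_dist_eq_lorentz (z w : UpperHalfPlane) :
    cosh (dist z w) = lorentz (hyperboloid z) (hyperboloid w) := by
  rw [cosh_dist']
  have hz := z.im_pos.ne'
  have hw := w.im_pos.ne'
  simp only [lorentz, hyperboloid, Matrix.cons_val_zero, Matrix.cons_val_one, Matrix.cons_val]
  field_simp
  ring

/-- The Lorentz form is definite on the orthogonal complement of a timelike vector. This replaces
the positivity of the norm used on the sphere. -/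
theorem eq_zero_of_lorentz {w x : Fin 3 → ℝ} (hx : lorentz x x = 1) (hwx : lorentz w x = 0)
    (hw : lorentz w w = 0) : w = 0 := by
  simp only [lorentz] at *
  -- Lagrange's identity for the spatial parts of `w` and `x`, combined with the three hypotheses.
  have e : (w 0) ^ 2 + (w 1 * x 2 - w 2 * x 1) ^ 2 = 0 := by
    linear_combination (-(w 0) ^ 2) * hx + (w 0 * x 0 + w 1 * x 1 + w 2 * x 2) * hwx
      - (x 1 ^ 2 + x 2 ^ 2) * hw
  have e0 : w 0 = 0 := by nlinarith [sq_nonneg (w 0), sq_nonneg (w 1 * x 2 - w 2 * x 1)]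
  have e1 : w 1 = 0 := by nlinarith [sq_nonneg (w 1), sq_nonneg (w 2)]
  have e2 : w 2 = 0 := by nlinarith [sq_nonneg (w 1), sq_nonneg (w 2)]
  ext i; fin_cases i <;> simp [e0, e1, e2]

/-- Interpolation on the hyperboloid: the difference of the two sides is null and orthogonal to the
timelike vector of `X`. -/
theorem sinh_dist_smul_eq {X A P : UpperHalfPlane} (h : dist X P + dist P A = dist X A) :
    sinh (dist X A) • hyperboloid P =
      sinh (dist P A) • hyperboloid X + sinh (dist X P) • hyperboloid A := by
  have hX := cosh_dist_eq_lorentz X X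
  have hA := cosh_dist_eq_lorentz A A
  have hP := cosh_dist_eq_lorentz P P
  have hXA := cosh_dist_eq_lorentz X A
  have hXP := cosh_dist_eq_lorentz X P
  have hPA := cosh_dist_eq_lorentz P A
  rw [dist_self, cosh_zero] at hX hA hP
  rw [← h, cosh_add] at hXA
  rw [← h, sinh_add]
  have e1 := cosh_sq (dist X P)
  have e2 := cosh_sq (dist P A)
  rw [← sub_eq_zero]
  refine eq_zero_of_lorentz hX.symm ?_ ?_
  · simp only [lorentz, Pi.sub_apply, Pi.add_apply, Pi.smul_apply, smul_eq_mul] at *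
    generalize dist X P = r at *
    generalize dist P A = s at *
    linear_combination sinh s * hX + sinh r * hXA -
      (sinh r * cosh s + cosh r * sinh s) * hXP + sinh s * e1
  · simp only [lorentz, Pi.sub_apply, Pi.add_apply, Pi.smul_apply, smul_eq_mul] at *
    generalize dist X P = r at *
    generalize dist P A = s at *
    linear_combination (-(sinh s)^2) * hX - (sinh r)^2 * hA -
      (sinh r * cosh s + cosh r * sinh s)^2 * hP - 2 * sinh s * sinh r * hXA +
      2 * (sinh r * cosh s + cosh r * sinh s) * sinh s * hXP +
      2 * (sinh r * cosh s + cosh r * sinh s) * sinh r * hPA - (sinh s)^2 * e1 - (sinh r)^2 * e2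

theorem sinh_mul_sinh_mul_cosh_sub {X A B P Q : UpperHalfPlane}
    (h : dist X P + dist P A = dist X A) (h' : dist X Q + dist Q B = dist X B) :
    sinh (dist X A) * sinh (dist X B) * (cosh (dist P Q) - cosh (dist X P - dist X Q)) =
      sinh (dist X P) * sinh (dist X Q) * (cosh (dist A B) - cosh (dist X A - dist X B)) := by
  have cPQ := cosh_dist_eq_lorentz P Q
  have cAB := cosh_dist_eq_lorentz A B
  have cXA := cosh_dist_eq_lorentz X A
  have cXB := cosh_dist_eq_lorentz X B
  have cX := cosh_dist_eq_lorentz X X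
  rw [dist_self, cosh_zero] at cX
  have h1 : lorentz (sinh (dist X A) • hyperboloid P) (sinh (dist X B) • hyperboloid Q) =
      lorentz (sinh (dist P A) • hyperboloid X + sinh (dist X P) • hyperboloid A)
        (sinh (dist Q B) • hyperboloid X + sinh (dist X Q) • hyperboloid B) := by
    rw [sinh_dist_smul_eq h, sinh_dist_smul_eq h']
  simp only [lorentz, Pi.add_apply, Pi.smul_apply, smul_eq_mul] at *
  have l1 : sinh (dist X A) * cosh (dist X P) =
      sinh (dist P A) + sinh (dist X P) * cosh (dist X A) := by
    rw [← h, sinh_add, cosh_add]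
    linear_combination (sinh (dist P A)) * cosh_sq (dist X P)
  have l2 : sinh (dist X B) * cosh (dist X Q) =
      sinh (dist Q B) + sinh (dist X Q) * cosh (dist X B) := by
    rw [← h', sinh_add, cosh_add]
    linear_combination (sinh (dist Q B)) * cosh_sq (dist X Q)
  rw [cosh_sub, cosh_sub]
  linear_combination (-(sinh (dist X B) * cosh (dist X Q))) * l1 -
    (sinh (dist P A) + sinh (dist X P) * cosh (dist X A)) * l2 + h1 +
    (sinh (dist X A) * sinh (dist X B)) * cPQ - sinh (dist X P) * sinh (dist X Q) * cAB
    - sinh (dist P A) * sinh (dist X Q) * cXB - sinh (dist Q B) * sinh (dist X P) * cXA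
    - sinh (dist P A) * sinh (dist Q B) * cX

end UpperHalfPlane

end Models

/-- The polar distance formula: the distance of points `P`, `Q` on segments `[X, A]`, `[X, B]` is
determined, through the generalized sine `S`, by the sides of the triangle `X A B`. -/
def IsPolarModel {M : Type*} (S : ℝ → ℝ) (d : M → M → ℝ) : Prop :=
  ∀ X A B P Q : M, d X P + d P A = d X A → d X Q + d Q B = d X B →
    S (d X A) * S (d X B) * (S (d P Q / 2) ^ 2 - S ((d X P - d X Q) / 2) ^ 2) =
      S (d X P) * S (d X Q) * (S (d A B / 2) ^ 2 - S ((d X A - d X B) / 2) ^ 2)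

open scoped Classical in
/-- The generalized sine of curvature `κ`, up to a positive factor. -/
noncomputable def curvSin (κ u : ℝ) : ℝ :=
  if 0 < κ then Real.sin (√κ * u) else if κ = 0 then u else Real.sinh (√(-κ) * u)

theorem curvSin_of_pos {κ : ℝ} (h : 0 < κ) : curvSin κ = fun u => Real.sin (√κ * u) := by
  funext u; simp [curvSin, h]

theorem curvSin_zero : curvSin 0 = fun u => u := by
  funext u; simp [curvSin]

theorem curvSin_of_neg {κ : ℝ} (h : κ < 0) : curvSin κ = fun u => Real.sinh (√(-κ) * u) := by
  funext u; simp [curvSin, h.not_gt, h.ne]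

theorem Real.sin_half_sq (x : ℝ) : Real.sin (x / 2) ^ 2 = (1 - Real.cos x) / 2 := by
  rw [Real.sin_sq_eq_half_sub, mul_div_cancel₀ x two_ne_zero]
  ring

theorem Real.sinh_half_sq (x : ℝ) : Real.sinh (x / 2) ^ 2 = (Real.cosh x - 1) / 2 := by
  have h := Real.cosh_two_mul (x / 2)
  have := Real.cosh_sq (x / 2)
  rw [mul_div_cancel₀ x two_ne_zero] at h
  linarith

theorem isPolarModel_modelSpace (κ : ℝ) : IsPolarModel (curvSin κ) (modelSpace κ).2 := by
  rcases lt_trichotomy 0 κ with h | h | h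
  · rw [modelSpace, if_pos h, curvSin_of_pos h]
    intro X A B P Q h1 h2
    have hk : √κ ≠ 0 := (Real.sqrt_pos.2 h).ne'
    have e : ∀ r : ℝ, √κ * (1 / √κ * r) = r := fun r => by field_simp
    have e2 : ∀ r : ℝ, √κ * (1 / √κ * r / 2) = r / 2 := fun r => by field_simp
    have e3 : ∀ r s : ℝ, √κ * ((1 / √κ * r - 1 / √κ * s) / 2) = (r - s) / 2 := fun r s => by
      field_simp
    have n : ∀ Y : sphere (0 : EuclideanSpace ℝ (Fin 3)) 1,
      ‖(Y : EuclideanSpace ℝ (Fin 3))‖ = 1 := fun Y => norm_eq_of_mem_sphere Y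
    have hk' : (1 / √κ) ≠ 0 := by simpa using hk
    simp only [← mul_add] at h1 h2
    have := sin_mul_sin_mul_cos_sub (n X) (n A) (n B) (n P) (n Q)
      (mul_left_cancel₀ hk' h1) (mul_left_cancel₀ hk' h2)
    simp only [e, e2, e3, Real.sin_half_sq]
    linear_combination this / 2
  · subst h
    rw [modelSpace, if_neg (lt_irrefl _), if_pos rfl, curvSin_zero]
    intro X A B P Q h1 h2
    have := dist_mul_dist_mul_dist_sq h1 h2
    simp only
    linear_combination this / 4
  · rw [modelSpace, if_neg h.not_gt, if_neg h.ne, curvSin_of_neg h]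
    intro X A B P Q h1 h2
    have hk : √(-κ) ≠ 0 := (Real.sqrt_pos.2 (neg_pos.2 h)).ne'
    have e : ∀ r : ℝ, √(-κ) * (1 / √(-κ) * r) = r := fun r => by field_simp
    have e2 : ∀ r : ℝ, √(-κ) * (1 / √(-κ) * r / 2) = r / 2 := fun r => by field_simp
    have e3 : ∀ r s : ℝ, √(-κ) * ((1 / √(-κ) * r - 1 / √(-κ) * s) / 2) = (r - s) / 2 :=
      fun r s => by field_simp
    have hk' : (1 / √(-κ)) ≠ 0 := by simpa using hk
    simp only [← mul_add] at h1 h2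
    have := UpperHalfPlane.sinh_mul_sinh_mul_cosh_sub
      (mul_left_cancel₀ hk' h1) (mul_left_cancel₀ hk' h2)
    simp only [e, e2, e3, Real.sinh_half_sq]
    linear_combination this / 2

/-! ### Generalized sines -/

/-- The properties of the generalized sine on `[0, B]` that are used below. -/
structure IsModelSine (S : ℝ → ℝ) (B : ℝ) : Prop where
  pos : 0 < B
  neg : ∀ u, S (-u) = -S u
  strictMono : StrictMonoOn S (Icc 0 B)
  linear_le : ∃ m > 0, ∀ u ∈ Icc 0 B, m * u ≤ S u
  sub_le : ∃ M > 0, ∀ u v, 0 ≤ u → u ≤ v → v ≤ B → S v - S u ≤ M * (v - u)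
  -- `R` stays below `B` because the derivative may vanish at the end of the interval, as for `sin`
  -- at `π / 2`.
  contract : ∀ R < B, ∃ c > 0, ∀ u ∈ Icc 0 R, ∀ t ∈ Icc (0 : ℝ) 1, S ((1 - t) * u) ≤ (1 - c * t) * S u
  superadd : ∀ a b, 0 ≤ a → 0 ≤ b → a + b ≤ B / 2 → S a ^ 2 + S b ^ 2 ≤ S (a + b) ^ 2

theorem IsModelSine.rescale {S : ℝ → ℝ} {B k : ℝ} (hk : 0 < k) (h : IsModelSine S (k * B)) :
    IsModelSine (fun u => S (k * u)) B where
  pos := pos_of_mul_pos_right h.pos hk.le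
  neg u := by rw [mul_neg, h.neg]
  strictMono u hu v hv huv := h.strictMono
    ⟨mul_nonneg hk.le hu.1, mul_le_mul_of_nonneg_left hu.2 hk.le⟩
    ⟨mul_nonneg hk.le hv.1, mul_le_mul_of_nonneg_left hv.2 hk.le⟩ (mul_lt_mul_of_pos_left huv hk)
  linear_le := by
    obtain ⟨m, hm, H⟩ := h.linear_le
    refine ⟨m * k, mul_pos hm hk, fun u hu => ?_⟩
    rw [mul_assoc]
    exact H _ ⟨mul_nonneg hk.le hu.1, mul_le_mul_of_nonneg_left hu.2 hk.le⟩
  sub_le := by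
    obtain ⟨M, hM, H⟩ := h.sub_le
    refine ⟨M * k, mul_pos hM hk, fun u v hu huv hv => ?_⟩
    rw [mul_assoc, mul_sub]
    exact H _ _ (mul_nonneg hk.le hu) (mul_le_mul_of_nonneg_left huv hk.le)
      (mul_le_mul_of_nonneg_left hv hk.le)
  contract R hR := by
    obtain ⟨c, hc, H⟩ := h.contract (k * R) (mul_lt_mul_of_pos_left hR hk)
    refine ⟨c, hc, fun u hu t ht => ?_⟩
    rw [mul_left_comm]
    exact H _ ⟨mul_nonneg hk.le hu.1, mul_le_mul_of_nonneg_left hu.2 hk.le⟩ t ht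
  superadd a b ha hb hab := by
    rw [mul_add]
    refine h.superadd _ _ (mul_nonneg hk.le ha) (mul_nonneg hk.le hb) ?_
    rw [← mul_add, mul_div_assoc]
    exact mul_le_mul_of_nonneg_left hab hk.le

theorem isModelSine_sin : IsModelSine Real.sin (Real.pi / 2) where
  pos := by positivity
  neg := Real.sin_neg
  strictMono := Real.strictMonoOn_sin.mono
    (Icc_subset_Icc_left (by have := Real.pi_pos; linarith))
  linear_le := ⟨2 / Real.pi, by positivity, fun u hu => Real.mul_le_sin hu.1 hu.2⟩
  sub_le := by
    refine ⟨1, one_pos, fun u v _ huv _ => ?_⟩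
    have h := Real.abs_sin_sub_sin_le v u
    rw [abs_of_nonneg (sub_nonneg.2 huv)] at h
    linarith [le_abs_self (Real.sin v - Real.sin u)]
  contract R hR := by
    have hpi := Real.pi_pos
    refine ⟨Real.cos (max R 0), Real.cos_pos_of_mem_Ioo ⟨by
      have := le_max_right R 0; linarith, max_lt hR (by positivity)⟩, fun u hu t ht => ?_⟩
    have hu2 : u < Real.pi / 2 := hu.2.trans_lt hR
    have hcos : Real.cos (max R 0) ≤ Real.cos u :=
      Real.cos_le_cos_of_nonneg_of_le_pi hu.1
        (max_le (by linarith) (by linarith)) (hu.2.trans (le_max_left _ _))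
    have hcu : 0 ≤ Real.cos u := Real.cos_nonneg_of_mem_Icc ⟨by linarith [hu.1], hu2.le⟩
    have hsu : 0 ≤ Real.sin u := Real.sin_nonneg_of_nonneg_of_le_pi hu.1 (by linarith)
    have htu : 0 ≤ t * u := mul_nonneg ht.1 hu.1
    have e : (1 - t) * u = u - t * u := by ring
    have htu' : t * u ≤ u := mul_le_of_le_one_left hu.1 ht.2
    -- By concavity the sine lies below its tangent at `u`; then `sin u ≤ u` turns the linear gain
    -- into a proportional one.
    have key : Real.sin (u - t * u) ≤ Real.sin u - t * u * Real.cos u := by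
      have hc := strictConcaveOn_sin_Icc.concaveOn
      rcases htu.eq_or_lt with h0 | h0
      · rw [← h0]; simp
      · have := hc.le_slope_of_hasDerivAt (x := u - t * u) (y := u) ⟨by linarith, by linarith⟩
          ⟨hu.1, by linarith⟩ (by linarith) (Real.hasDerivAt_sin u)
        rw [slope_def_field, le_div_iff₀ (by linarith)] at this
        linarith
    have h1 : Real.sin u ≤ u := Real.sin_le hu.1
    rw [e]
    have h2 : t * Real.sin u * Real.cos (max R 0) ≤ t * u * Real.cos u :=
      mul_le_mul (mul_le_mul_of_nonneg_left h1 ht.1) hcos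
        (Real.cos_nonneg_of_mem_Icc ⟨by have := le_max_right R 0; linarith,
          max_le hR.le (by positivity)⟩) htu
    linarith
  superadd a b ha hb hab := by
    have hpi := Real.pi_pos
    have h1 : 0 ≤ Real.sin a := Real.sin_nonneg_of_nonneg_of_le_pi ha (by linarith)
    have h2 : 0 ≤ Real.sin b := Real.sin_nonneg_of_nonneg_of_le_pi hb (by linarith)
    have h3 : 0 ≤ Real.cos (a + b) := Real.cos_nonneg_of_mem_Icc ⟨by linarith, by linarith⟩
    have h4 := mul_nonneg (mul_nonneg h1 h2) h3
    rw [Real.cos_add] at h4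
    rw [Real.sin_add]
    have e1 := Real.sin_sq_add_cos_sq a
    have e2 := Real.sin_sq_add_cos_sq b
    have : (Real.sin a * Real.cos b + Real.cos a * Real.sin b) ^ 2 =
        Real.sin a ^ 2 + Real.sin b ^ 2 + 2 * (Real.sin a * Real.sin b *
          (Real.cos a * Real.cos b - Real.sin a * Real.sin b)) := by
      linear_combination (Real.sin a) ^ 2 * e2 + (Real.sin b) ^ 2 * e1
    linarith

theorem isModelSine_id {B : ℝ} (hB : 0 < B) : IsModelSine (fun u => u) B where
  pos := hB
  neg _ := rfl
  strictMono := strictMono_id.strictMonoOn _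
  linear_le := ⟨1, one_pos, fun u _ => by simp⟩
  sub_le := ⟨1, one_pos, fun u v _ _ _ => by simp⟩
  contract R _ := ⟨1, one_pos, fun u _ t _ => by simp⟩
  superadd a b ha hb _ := by nlinarith [mul_nonneg ha hb]

theorem isModelSine_sinh {B : ℝ} (hB : 0 < B) : IsModelSine Real.sinh B where
  pos := hB
  neg := Real.sinh_neg
  strictMono := Real.sinh_strictMono.strictMonoOn _
  linear_le := ⟨1, one_pos, fun u hu => by simpa using Real.self_le_sinh_iff.2 hu.1⟩
  sub_le := by
    refine ⟨Real.cosh B, Real.cosh_pos B, fun u v hu huv hv => ?_⟩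
    refine (convex_Icc 0 B).image_sub_le_mul_sub_of_deriv_le Real.continuous_sinh.continuousOn
      Real.differentiable_sinh.differentiableOn ?_ u ⟨hu, huv.trans hv⟩ v ⟨hu.trans huv, hv⟩ huv
    intro w hw
    rw [interior_Icc] at hw
    rw [Real.deriv_sinh, Real.cosh_le_cosh, abs_of_pos hw.1, abs_of_pos hB]
    exact hw.2.le
  contract R _ := by
    refine ⟨1, one_pos, fun u hu t ht => ?_⟩
    have hc : ConvexOn ℝ (Ici 0) Real.sinh := by
      refine MonotoneOn.convexOn_of_deriv (convex_Ici 0) Real.continuous_sinh.continuousOn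
        Real.differentiable_sinh.differentiableOn ?_
      rw [Real.deriv_sinh]
      intro a ha b hb hab
      rw [interior_Ici] at ha hb
      rw [Real.cosh_le_cosh, abs_of_pos ha, abs_of_pos hb]
      exact hab
    have := hc.2 (x := 0) (y := u) (by simp) hu.1 ht.1 (sub_nonneg.2 ht.2) (by ring)
    simpa using this
  superadd a b ha hb _ := by
    have h1 := Real.sinh_nonneg_iff.2 ha
    have h2 := Real.sinh_nonneg_iff.2 hb
    have h3 := Real.one_le_cosh a
    have h4 := Real.one_le_cosh b
    rw [Real.sinh_add]
    nlinarith [mul_nonneg h1 h2, mul_le_mul_of_nonneg_left h4 h1, mul_le_mul_of_nonneg_right h3 h2]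

theorem isModelSine_curvSin_of_pos {κ : ℝ} (h : 0 < κ) :
    IsModelSine (curvSin κ) (Real.pi / √κ / 2) := by
  rw [curvSin_of_pos h]
  have hk := Real.sqrt_pos.2 h
  refine IsModelSine.rescale hk ?_
  have : √κ * (Real.pi / √κ / 2) = Real.pi / 2 := by field_simp
  rw [this]
  exact isModelSine_sin

theorem isModelSine_curvSin_of_nonpos {κ B : ℝ} (h : κ ≤ 0) (hB : 0 < B) :
    IsModelSine (curvSin κ) B := by
  rcases h.eq_or_lt with rfl | h
  · rw [curvSin_zero]; exact isModelSine_id hB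
  · rw [curvSin_of_neg h]
    have hk := Real.sqrt_pos.2 (neg_pos.2 h)
    exact IsModelSine.rescale hk (isModelSine_sinh (mul_pos hk hB))

namespace IsModelSine

variable {S : ℝ → ℝ} {B : ℝ}

theorem zero (h : IsModelSine S B) : S 0 = 0 := by
  have := h.neg 0
  rw [neg_zero] at this
  linarith

theorem mono (h : IsModelSine S B) {u v : ℝ} (hu : 0 ≤ u) (huv : u ≤ v) (hv : v ≤ B) :
    S u ≤ S v := h.strictMono.monotoneOn ⟨hu, huv.trans hv⟩ ⟨hu.trans huv, hv⟩ huv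

theorem nonneg (h : IsModelSine S B) {u : ℝ} (hu : 0 ≤ u) (hu' : u ≤ B) : 0 ≤ S u := by
  rw [← h.zero]; exact h.mono le_rfl hu hu'

theorem pos_of_pos (h : IsModelSine S B) {u : ℝ} (hu : 0 < u) (hu' : u ≤ B) : 0 < S u := by
  rw [← h.zero]; exact h.strictMono ⟨le_rfl, h.pos.le⟩ ⟨hu.le, hu'⟩ hu

theorem abs_sq (h : IsModelSine S B) (u : ℝ) : S |u| ^ 2 = S u ^ 2 := by
  rcases abs_cases u with ⟨e, _⟩ | ⟨e, _⟩ <;> simp [e, h.neg]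

theorem sq_mono (h : IsModelSine S B) {u v : ℝ} (huv : |u| ≤ v) (hv : v ≤ B) :
    S u ^ 2 ≤ S v ^ 2 := by
  rw [← h.abs_sq u]
  exact pow_le_pow_left₀ (h.nonneg (abs_nonneg _) (huv.trans hv)) (h.mono (abs_nonneg _) huv hv) 2

theorem le_of_sq_le (h : IsModelSine S B) {u v : ℝ} (hu : 0 ≤ u) (hu' : u ≤ B) (hv : 0 ≤ v)
    (hv' : v ≤ B) (huv : S u ^ 2 ≤ S v ^ 2) : u ≤ v :=
  (h.strictMono.le_iff_le ⟨hu, hu'⟩ ⟨hv, hv'⟩).1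
    ((sq_le_sq₀ (h.nonneg hu hu') (h.nonneg hv hv')).1 huv)

end IsModelSine

namespace IsModelSine

variable {S : ℝ → ℝ} {B : ℝ}

/-- A definite part of the contraction `u ↦ (1 - t) u` may be spent on an increment proportional
to `P`, in the interval `[δ, P]`. -/
theorem exists_slack (h : IsModelSine S B) {R : ℝ} (hR : R < B) :
    ∃ c > 0, c ≤ 1 ∧ ∃ e > 0, e ≤ 1 ∧
      (∀ u ∈ Icc 0 R, ∀ t ∈ Icc (0 : ℝ) 1, S ((1 - t) * u) ≤ (1 - c * t) * S u) ∧
      ∀ t ∈ Icc (0 : ℝ) 1, ∀ δ P, 0 ≤ δ → δ ≤ B / 2 → δ ≤ P → P ≤ B →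
        S ((1 - t) * δ + e * t * P) ^ 2 ≤ (1 - c * t) * S δ ^ 2 + c * t * S P ^ 2 := by
  obtain ⟨m, hm, Hm⟩ := h.linear_le
  obtain ⟨M, hM, HM⟩ := h.sub_le
  have hB := h.pos
  obtain ⟨c₀, hc₀, Hc₀⟩ := h.contract (max R (B / 2)) (max_lt hR (by linarith))
  have hmM : m ≤ M := by
    have h1 := Hm B ⟨hB.le, le_rfl⟩
    have h2 := HM 0 B le_rfl hB.le le_rfl
    rw [h.zero] at h2
    exact le_of_mul_le_mul_right (by linarith) hB
  -- Half of the available rate: contraction by only `t / 2` still yields the factor `1 - c * t`.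
  set c := min c₀ 1 / 2 with hc
  have hcpos : 0 < c := by have : 0 < min c₀ 1 := lt_min hc₀ one_pos; positivity
  have hc1 : 2 * c ≤ 1 := by rw [hc]; linarith [min_le_right c₀ 1]
  have hc2 : 2 * c ≤ c₀ := by rw [hc]; linarith [min_le_left c₀ 1]
  have Hc : ∀ u ∈ Icc 0 (max R (B / 2)), ∀ t ∈ Icc (0 : ℝ) 1,
      S ((1 - t) * u) ≤ (1 - 2 * c * t) * S u := by
    intro u hu t ht
    refine (Hc₀ u hu t ht).trans (mul_le_mul_of_nonneg_right ?_ (h.nonneg hu.1 (hu.2.trans ?_)))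
    · have := mul_le_mul_of_nonneg_right hc2 ht.1
      linarith
    · exact max_le hR.le (by linarith)
  set e := c * m / (3 * M) with he
  have hepos : 0 < e := by positivity
  have heM : 3 * M * e = c * m := by rw [he]; field_simp
  have he6 : e ≤ 1 / 6 := by
    rw [he, div_le_iff₀ (by positivity)]
    nlinarith
  refine ⟨c, hcpos, by linarith, e, hepos, by linarith, ?_, ?_⟩
  · intro u hu t ht
    have hu' : u ∈ Icc 0 (max R (B / 2)) := ⟨hu.1, hu.2.trans (le_max_left _ _)⟩
    refine (Hc u hu' t ht).trans (mul_le_mul_of_nonneg_right ?_ (h.nonneg hu.1 (hu.2.trans hR.le)))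
    nlinarith [mul_nonneg hcpos.le ht.1]
  intro t ht δ P hδ hδB hδP hPB
  have hP : 0 ≤ P := hδ.trans hδP
  have hct : 0 ≤ c * t := mul_nonneg hcpos.le ht.1
  have hct1 : c * t ≤ 1 := mul_le_one₀ (by linarith) ht.1 ht.2
  have hetP : 0 ≤ e * t * P := mul_nonneg (mul_nonneg hepos.le ht.1) hP
  have h1t : 0 ≤ (1 - t) * δ := mul_nonneg (sub_nonneg.2 ht.2) hδ
  -- If the increment is at most half of what the contraction removes, the other half suffices.
  -- Otherwise `δ ≤ 2 * e * P`, and the growth of `S ^ 2`, of order `(M * e * P) ^ 2 * t`, is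
  -- covered by `c * t * S P ^ 2` thanks to the choice of `e`.
  rcases le_total (e * t * P) (t / 2 * δ) with hcase | hcase
  · have h1 : S ((1 - t) * δ + e * t * P) ≤ S ((1 - t / 2) * δ) := by
      refine h.mono (by positivity) (by linarith) ?_
      have := mul_nonneg ht.1 hδ
      linarith
    have h2 := Hc δ ⟨hδ, hδB.trans (le_max_right _ _)⟩ (t / 2)
      ⟨by linarith [ht.1], by linarith [ht.2]⟩
    have h3 : S ((1 - t) * δ + e * t * P) ≤ (1 - c * t) * S δ := by
      refine h1.trans (h2.trans (le_of_eq (by ring)))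
    have h0 : 0 ≤ S ((1 - t) * δ + e * t * P) := by
      refine h.nonneg (by positivity) ?_
      have := mul_nonneg ht.1 hδ
      linarith
    have h4 : S ((1 - t) * δ + e * t * P) ^ 2 ≤ ((1 - c * t) * S δ) ^ 2 :=
      pow_le_pow_left₀ h0 h3 2
    have h5 : (1 - c * t) ^ 2 ≤ 1 - c * t := by nlinarith
    have h6 := mul_le_mul_of_nonneg_right h5 (sq_nonneg (S δ))
    have h7 := mul_nonneg hct (sq_nonneg (S P))
    rw [mul_pow] at h4
    linarith
  · rcases ht.1.eq_or_lt with h0 | h0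
    · rw [← h0]; simp
    have hδ2 : δ ≤ 2 * e * P := by
      have : t * δ ≤ t * (2 * e * P) := by linarith
      exact le_of_mul_le_mul_left this h0
    have htP : t * P ≤ P := mul_le_of_le_one_left hP ht.2
    set w := δ + e * t * P with hw
    have hw3 : w ≤ 3 * e * P := by
      have := mul_le_mul_of_nonneg_left htP hepos.le
      rw [hw]; linarith
    have hwB : w ≤ B := by nlinarith
    have hw0 : 0 ≤ w := by positivity
    have h1 : S ((1 - t) * δ + e * t * P) ^ 2 ≤ S w ^ 2 := by
      refine h.sq_mono ?_ hwB
      rw [abs_of_nonneg (by positivity)]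
      have := mul_nonneg ht.1 hδ
      linarith
    have hSw := HM 0 w le_rfl hw0 hwB
    rw [h.zero, sub_zero, sub_zero] at hSw
    have hSδ := HM 0 δ le_rfl hδ (by linarith)
    rw [h.zero, sub_zero, sub_zero] at hSδ
    have hSwδ := HM δ w hδ (by linarith) hwB
    have hδ0 := h.nonneg hδ (by linarith)
    have hSmono := h.mono hδ (by linarith : δ ≤ w) hwB
    have hSP := Hm P ⟨hP, hPB⟩
    have a1 : S w ^ 2 - S δ ^ 2 ≤ (M * (e * t * P)) * (2 * (M * (3 * e * P))) := by
      have e1 : S w - S δ ≤ M * (e * t * P) := by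
        refine hSwδ.trans (le_of_eq ?_); rw [hw]; ring
      have e2 : S w + S δ ≤ 2 * (M * (3 * e * P)) := by
        have := mul_le_mul_of_nonneg_left hw3 hM.le
        linarith
      have : S w ^ 2 - S δ ^ 2 = (S w - S δ) * (S w + S δ) := by ring
      rw [this]
      exact mul_le_mul e1 e2 (by linarith) (by positivity)
    have a2 : (m * P) ^ 2 ≤ S P ^ 2 := pow_le_pow_left₀ (by positivity) hSP 2
    have a3 : S δ ^ 2 ≤ (M * (2 * e * P)) ^ 2 :=
      pow_le_pow_left₀ hδ0 (hSδ.trans (mul_le_mul_of_nonneg_left hδ2 hM.le)) 2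
    have a4 : c * t * (S P ^ 2 - S δ ^ 2) ≥ c * t * ((m * P) ^ 2 - (M * (2 * e * P)) ^ 2) :=
      mul_le_mul_of_nonneg_left (by linarith) hct
    have a5 : (M * (e * t * P)) * (2 * (M * (3 * e * P))) ≤
        c * t * ((m * P) ^ 2 - (M * (2 * e * P)) ^ 2) := by
      have i1 : (M * (e * t * P)) * (2 * (M * (3 * e * P))) = t * P ^ 2 * (2 / 3 * (3 * M * e) ^ 2) := by
        ring
      have i2 : c * t * ((m * P) ^ 2 - (M * (2 * e * P)) ^ 2) =
          t * P ^ 2 * (c * (m ^ 2 - 4 / 9 * (3 * M * e) ^ 2)) := by ring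
      rw [i1, i2, heM]
      refine mul_le_mul_of_nonneg_left ?_ (by positivity)
      have : c * (m ^ 2 - 4 / 9 * (c * m) ^ 2) - 2 / 3 * (c * m) ^ 2 =
          c * m ^ 2 * (1 - 4 / 9 * c ^ 2 - 2 / 3 * c) := by ring
      have h2 : 0 ≤ 1 - 4 / 9 * c ^ 2 - 2 / 3 * c := by nlinarith
      have h3 : 0 ≤ c * m ^ 2 * (1 - 4 / 9 * c ^ 2 - 2 / 3 * c) := by positivity
      linarith
    linarith

end IsModelSine

/-! ### Radial structures -/

/-- `pos a r` is the point at distance `r` from the pole `x` on a segment joining `x` to `a`; these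
segments diverge from each other at most as in the model space with generalized sine `S`. -/
structure IsRadial {Y : Type*} [MetricSpace Y] (x : Y) (pos : Y → ℝ → Y) (S : ℝ → ℝ) (B : ℝ) :
    Prop where
  sine : IsModelSine S B
  dist_lt : ∀ a, dist a x < B
  dist_pos : ∀ a, ∀ r ∈ Icc 0 (dist a x), ∀ s ∈ Icc 0 (dist a x),
    dist (pos a r) (pos a s) = |r - s|
  pos_zero : ∀ a, pos a 0 = x
  pos_self : ∀ a, pos a (dist a x) = a
  -- `H` plays the part of `sin² (θ / 2)`, with `θ` the comparison angle at the pole.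
  compare : ∀ a b, ∃ H ≥ 0,
    S (dist a b / 2) ^ 2 = S ((dist a x - dist b x) / 2) ^ 2 + S (dist a x) * S (dist b x) * H ∧
    ∀ r ∈ Icc 0 (dist a x), ∀ s ∈ Icc 0 (dist b x),
      S (dist (pos a r) (pos b s) / 2) ^ 2 ≤ S ((r - s) / 2) ^ 2 + S r * S s * H

namespace IsRadial

variable {Y : Type*} [MetricSpace Y] {x : Y} {pos : Y → ℝ → Y} {S : ℝ → ℝ} {B : ℝ}

theorem dist_pos_pole (h : IsRadial x pos S B) (a : Y) {r : ℝ} (hr : r ∈ Icc 0 (dist a x)) :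
    dist (pos a r) x = r := by
  have := h.dist_pos a r hr 0 ⟨le_rfl, dist_nonneg⟩
  rwa [h.pos_zero, sub_zero, abs_of_nonneg hr.1] at this

theorem dist_pos_self (h : IsRadial x pos S B) (a : Y) {r : ℝ} (hr : r ∈ Icc 0 (dist a x)) :
    dist (pos a r) a = dist a x - r := by
  have := h.dist_pos a r hr _ ⟨dist_nonneg, le_rfl⟩
  rwa [h.pos_self, abs_sub_comm, abs_of_nonneg (sub_nonneg.2 hr.2)] at this

theorem dist_half_lt (h : IsRadial x pos S B) (a b : Y) : dist a b / 2 < B := by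
  have := dist_triangle_right a b x
  linarith [h.dist_lt a, h.dist_lt b]

/-- The distance of `pos a r` and `a` is the difference of their radii, so their angle term `H`
vanishes, and points of equal radius on the two segments coincide. -/
theorem pos_pos (h : IsRadial x pos S B) (a : Y) {r s : ℝ} (hr : r ∈ Icc 0 (dist a x))
    (hs : s ∈ Icc 0 r) : pos (pos a r) s = pos a s := by
  have hrx := h.dist_pos_pole a hr
  rcases hs.1.eq_or_lt with h0 | h0
  · rw [← h0, h.pos_zero, h.pos_zero]
  have hr0 : 0 < r := h0.trans_le hs.2
  have hB := h.dist_lt a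
  obtain ⟨H, hH, h1, h2⟩ := h.compare (pos a r) a
  rw [hrx, h.dist_pos_self a hr] at h1
  have e : S ((r - dist a x) / 2) ^ 2 = S ((dist a x - r) / 2) ^ 2 := by
    rw [← h.sine.abs_sq, ← h.sine.abs_sq ((dist a x - r) / 2)]
    congr 2
    rw [← abs_neg]; congr 1; ring
  have p1 := h.sine.pos_of_pos hr0 (hr.2.trans hB.le)
  have p2 := h.sine.pos_of_pos (hr0.trans_le hr.2) hB.le
  have hH0 : H = 0 := by
    have h3 : S r * S (dist a x) * H = 0 := by linarith
    rcases mul_eq_zero.1 h3 with h4 | h4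
    · exact absurd h4 (mul_pos p1 p2).ne'
    · exact h4
  have h3 := h2 s (by rw [hrx]; exact hs) s ⟨hs.1, hs.2.trans hr.2⟩
  rw [hH0, sub_self, zero_div, mul_zero, add_zero] at h3
  have := h.sine.le_of_sq_le (by positivity) (h.dist_half_lt _ _).le le_rfl h.sine.pos.le h3
  exact dist_le_zero.1 (by linarith)

end IsRadial

/-! ### Stars in `CAT(κ)` spaces -/

/-- For `κ > 0` the generalized sine increases only up to `D_κ / 2`, which suffices because model
distances do not exceed `D_κ`. -/
theorem curvSin_half_sq_le (κ : ℝ) (p q : (modelSpace κ).1) {u : ℝ} (hu : 0 ≤ u)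
    (hu' : u ≤ (modelSpace κ).2 p q) :
    curvSin κ (u / 2) ^ 2 ≤ curvSin κ ((modelSpace κ).2 p q / 2) ^ 2 := by
  have hab : |u / 2| ≤ (modelSpace κ).2 p q / 2 := by
    rw [abs_of_nonneg (by positivity)]; linarith
  rcases lt_or_ge 0 κ with h | h
  · refine (isModelSine_curvSin_of_pos h).sq_mono hab ?_
    have : ∀ m : (M : Type) × (M → M → ℝ), m = (modelSpace κ) →
        ∀ p q, m.2 p q ≤ Real.pi / √κ := by
      rw [modelSpace, if_pos h]
      rintro m rfl p q
      have := Real.sqrt_pos.2 h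
      simp only [one_div, inv_mul_eq_div]
      gcongr
      exact InnerProductGeometry.angle_le_pi _ _
    linarith [this _ rfl p q]
  · have h0 : 0 ≤ (modelSpace κ).2 p q / 2 := by linarith
    exact (isModelSine_curvSin_of_nonpos h (B := (modelSpace κ).2 p q / 2 + 1)
      (by linarith)).sq_mono hab (by linarith)

/-- `γ` runs through a metric segment from `x` to `a`, at unit speed. -/
def IsUnitSegment {X : Type*} [MetricSpace X] (x a : X) (γ : ℝ → X) : Prop :=
  γ 0 = x ∧ γ (dist a x) = a ∧
    ∀ s ∈ Icc 0 (dist a x), ∀ t ∈ Icc 0 (dist a x), dist (γ s) (γ t) = |s - t|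

namespace IsUnitSegment

variable {X : Type*} [MetricSpace X] {x a : X} {γ : ℝ → X}

theorem isMetricSegment (h : IsUnitSegment x a γ) :
    IsMetricSegment dist x a (γ '' Icc 0 (dist a x)) := by
  refine ⟨γ, h.1, ?_, ?_, ?_⟩
  · rw [dist_comm]; exact h.2.1
  · rw [dist_comm x a]; exact h.2.2
  · rw [dist_comm]

theorem isMetricSegment_reverse (h : IsUnitSegment x a γ) :
    IsMetricSegment dist a x (γ '' Icc 0 (dist a x)) := by
  refine ⟨fun t => γ (dist a x - t), by simpa using h.2.1, by simpa using h.1, ?_, ?_⟩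
  · intro s hs t ht
    rw [h.2.2 _ ⟨by linarith [hs.2], by linarith [hs.1]⟩ _ ⟨by linarith [ht.2], by linarith [ht.1]⟩,
      abs_sub_comm]
    congr 1; ring
  · have := image_comp γ (fun t => dist a x - t) (Icc 0 (dist a x))
    rw [image_const_sub_Icc, sub_self, sub_zero] at this
    exact this

theorem dist_left (h : IsUnitSegment x a γ) {r : ℝ} (hr : r ∈ Icc 0 (dist a x)) :
    dist (γ r) x = r := by
  have := h.2.2 r hr 0 ⟨le_rfl, dist_nonneg⟩
  rwa [h.1, sub_zero, abs_of_nonneg hr.1] at this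

theorem dist_right (h : IsUnitSegment x a γ) {r : ℝ} (hr : r ∈ Icc 0 (dist a x)) :
    dist (γ r) a = dist a x - r := by
  have := h.2.2 r hr _ ⟨dist_nonneg, le_rfl⟩
  rwa [h.2.1, abs_sub_comm, abs_of_nonneg (sub_nonneg.2 hr.2)] at this

end IsUnitSegment

theorem IsMetricSegment.exists_isUnitSegment {X : Type*} [MetricSpace X] {a x : X} {T : Set X}
    (h : IsMetricSegment dist a x T) :
    ∃ γ, IsUnitSegment x a γ ∧ γ '' Icc 0 (dist a x) = T := by
  obtain ⟨c, h0, h1, h2, h3⟩ := h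
  refine ⟨fun t => c (dist a x - t), ⟨by simpa using h1, by simpa using h0, ?_⟩, ?_⟩
  · intro s hs t ht
    rw [h2 _ ⟨by linarith [hs.2], by linarith [hs.1]⟩ _ ⟨by linarith [ht.2], by linarith [ht.1]⟩,
      abs_sub_comm]
    congr 1; ring
  · have := image_comp c (fun t => dist a x - t) (Icc 0 (dist a x))
    rw [image_const_sub_Icc, sub_self, sub_zero, h3] at this
    exact this

theorem IsCATSpace.exists_compare {κ : ℝ} {X : Type*} [MetricSpace X] (hX : IsCATSpace κ X)
    {x a b : X} (ha : edist a x < modelDiam κ / 2) (hb : edist b x < modelDiam κ / 2)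
    {γ δ : ℝ → X} (hγ : IsUnitSegment x a γ) (hδ : IsUnitSegment x b δ)
    {r s : ℝ} (hr : r ∈ Icc 0 (dist a x)) (hs : s ∈ Icc 0 (dist b x)) :
    ∃ l ≥ dist (γ r) (δ s), curvSin κ (dist (γ r) (δ s) / 2) ^ 2 ≤ curvSin κ (l / 2) ^ 2 ∧
      curvSin κ (dist a x) * curvSin κ (dist b x) *
        (curvSin κ (l / 2) ^ 2 - curvSin κ ((r - s) / 2) ^ 2) = curvSin κ r * curvSin κ s *
        (curvSin κ (dist a b / 2) ^ 2 - curvSin κ ((dist a x - dist b x) / 2) ^ 2) := by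
  have hD : modelDiam κ / 2 + modelDiam κ / 2 = modelDiam κ := ENNReal.add_halves _
  have habx : edist a x + edist b x < modelDiam κ := by
    rw [← hD]; exact ENNReal.add_lt_add ha hb
  have hab : edist a b ≤ edist a x + edist b x := edist_triangle_right a b x
  obtain ⟨U, hU⟩ := hX.exists_segment a b (hab.trans_lt habx)
  let T : GeodesicTriangle (dist : X → X → ℝ) :=
    { vertex := ![x, a, b]
      side := ![γ '' Icc 0 (dist a x), U, δ '' Icc 0 (dist b x)]
      isMetricSegment_side := by
        intro i
        fin_cases i
        · exact hγ.isMetricSegment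
        · exact hU
        · exact hδ.isMetricSegment_reverse }
  have hT : edist (T.vertex 0) (T.vertex 1) + edist (T.vertex 1) (T.vertex 2)
      + edist (T.vertex 2) (T.vertex 0) < 2 * modelDiam κ := by
    change edist x a + edist a b + edist b x < 2 * modelDiam κ
    rw [two_mul, edist_comm x a, add_right_comm]
    exact ENNReal.add_lt_add habx (hab.trans_lt habx)
  obtain ⟨d, hd⟩ : ∃ d, d = (modelSpace κ).2 := ⟨_, rfl⟩
  have hthin := hX.thin T hT
  rw [← hd] at hthin
  obtain ⟨T', hT', hthin⟩ := hthin
  have v01 : d (T'.vertex 0) (T'.vertex 1) = dist a x := by rw [hT', dist_comm]; rfl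
  have v20 : d (T'.vertex 2) (T'.vertex 0) = dist b x := by rw [hT']; rfl
  have v02 : d (T'.vertex 0) (T'.vertex 2) = dist b x := by rw [hT', dist_comm]; rfl
  have v12 : d (T'.vertex 1) (T'.vertex 2) = dist a b := by rw [hT']; rfl
  obtain ⟨c, c0, c1, cd, cs⟩ := T'.isMetricSegment_side 0
  obtain ⟨c', c0', c1', cd', cs'⟩ := T'.isMetricSegment_side 2
  change c (d (T'.vertex 0) (T'.vertex 1)) = T'.vertex 1 at c1
  change ∀ s ∈ Icc 0 (d (T'.vertex 0) (T'.vertex 1)), ∀ t ∈ Icc 0 (d (T'.vertex 0) (T'.vertex 1)),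
    d (c s) (c t) = |s - t| at cd
  change c '' Icc 0 (d (T'.vertex 0) (T'.vertex 1)) = _ at cs
  change c' (d (T'.vertex 2) (T'.vertex 0)) = T'.vertex 0 at c1'
  change ∀ s ∈ Icc 0 (d (T'.vertex 2) (T'.vertex 0)), ∀ t ∈ Icc 0 (d (T'.vertex 2) (T'.vertex 0)),
    d (c' s) (c' t) = |s - t| at cd'
  change c' '' Icc 0 (d (T'.vertex 2) (T'.vertex 0)) = _ at cs'
  rw [v01] at c1 cd cs
  rw [v20] at c1' cd' cs'
  have m0 : ∀ {z : ℝ}, 0 ≤ z → (0 : ℝ) ∈ Icc 0 z := fun h => ⟨le_rfl, h⟩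
  have m1 : ∀ {z : ℝ}, 0 ≤ z → z ∈ Icc 0 z := fun h => ⟨h, le_rfl⟩
  -- The third side runs from `b` to `x`, so radius `s` has parameter `dist b x - s` on it.
  have hs' : dist b x - s ∈ Icc 0 (dist b x) := ⟨by linarith [hs.2], by linarith [hs.1]⟩
  have a0 : (0 : ℝ) ≤ dist a x := dist_nonneg
  have b0 : (0 : ℝ) ≤ dist b x := dist_nonneg
  have P0 : d (T'.vertex 0) (c r) = r := by
    rw [← c0, cd _ (m0 a0) _ hr, zero_sub, abs_neg, abs_of_nonneg hr.1]
  have P0' : d (c r) (T'.vertex 0) = r := by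
    rw [← c0, cd _ hr _ (m0 a0), sub_zero, abs_of_nonneg hr.1]
  have P1 : d (c r) (T'.vertex 1) = dist a x - r := by
    rw [← c1, cd _ hr _ (m1 a0), abs_sub_comm, abs_of_nonneg (by linarith [hr.2])]
  have Q0 : d (T'.vertex 0) (c' (dist b x - s)) = s := by
    rw [← c1', cd' _ (m1 b0) _ hs', sub_sub_cancel, abs_of_nonneg hs.1]
  have Q0' : d (c' (dist b x - s)) (T'.vertex 0) = s := by
    rw [← c1', cd' _ hs' _ (m1 b0), abs_sub_comm, sub_sub_cancel, abs_of_nonneg hs.1]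
  have Q2 : d (c' (dist b x - s)) (T'.vertex 2) = dist b x - s := by
    rw [← c0', cd' _ hs' _ (m0 b0), sub_zero, abs_of_nonneg hs'.1]
  have hle : dist (γ r) (δ s) ≤ d (c r) (c' (dist b x - s)) := by
    refine hthin 0 2 _ _ _ _ ⟨mem_image_of_mem _ hr, ?_, ?_, ?_⟩ ⟨mem_image_of_mem _ hs, ?_, ?_, ?_⟩
    · rw [← cs]; exact mem_image_of_mem _ hr
    · exact P0'.trans (hγ.dist_left hr).symm
    · exact P1.trans (hγ.dist_right hr).symm
    · rw [← cs']; exact mem_image_of_mem _ hs'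
    · exact Q2.trans (hδ.dist_right hs).symm
    · exact Q0'.trans (hδ.dist_left hs).symm
  refine ⟨_, hle, by subst hd; exact curvSin_half_sq_le κ _ _ dist_nonneg hle, ?_⟩
  have := isPolarModel_modelSpace κ (T'.vertex 0) (T'.vertex 1) (T'.vertex 2) (c r)
    (c' (dist b x - s)) (by rw [← hd, P0, P1, v01]; ring) (by rw [← hd, Q0, Q2, v02]; ring)
  rw [← hd, P0, Q0, v01, v02, v12] at this
  exact this

/-- A star about `x` in a `CAT(κ)` space, of radius less than `D_κ / 2`, has a radial structure. -/
theorem IsCATSpace.exists_isRadial {κ : ℝ} {X : Type*} [MetricSpace X] (hX : IsCATSpace κ X)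
    {C : Set X} (x : C) {B : ℝ} (hB : IsModelSine (curvSin κ) B)
    (hC_lt : ∀ z ∈ C, dist z x < B) (hC_ball : ∀ z ∈ C, edist z x < modelDiam κ / 2)
    (hC_star : ∀ z ∈ C, ∀ T : Set X, IsMetricSegment dist z x T → T ⊆ C) :
    ∃ pos : C → ℝ → C, IsRadial x pos (curvSin κ) B := by
  have key : ∀ a : C, ∃ γ : ℝ → C, IsUnitSegment (x : X) a (fun t => (γ t : X)) := by
    intro a
    obtain ⟨T, hT⟩ := hX.exists_segment a x ((hC_ball a a.2).trans_le ENNReal.half_le_self)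
    have hTC := hC_star a a.2 T hT
    obtain ⟨γ, hγ, hγT⟩ := hT.exists_isUnitSegment
    classical
    have hmem : ∀ t ∈ Icc 0 (dist (a : X) x), γ t ∈ C := fun t ht =>
      hTC (hγT ▸ mem_image_of_mem γ ht)
    have hval : ∀ t ∈ Icc 0 (dist (a : X) x),
        (((fun t => if h : t ∈ Icc 0 (dist (a : X) x) then (⟨γ t, hmem t h⟩ : C) else x) t : C) : X)
          = γ t := by
      intro t ht
      simp only [dif_pos ht]
    refine ⟨fun t => if h : t ∈ Icc 0 (dist (a : X) x) then ⟨γ t, hmem t h⟩ else x, ?_, ?_, ?_⟩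
    · exact (hval 0 ⟨le_rfl, dist_nonneg⟩).trans hγ.1
    · exact (hval _ ⟨dist_nonneg, le_rfl⟩).trans hγ.2.1
    · intro s hs t ht
      have := hγ.2.2 s hs t ht
      rwa [← hval s hs, ← hval t ht] at this
  choose pos hpos using key
  refine ⟨pos, hB, fun a => hC_lt a a.2, fun a => (hpos a).2.2,
    fun a => Subtype.ext (hpos a).1, fun a => Subtype.ext (hpos a).2.1, ?_⟩
  intro a b
  have ha : dist a x < B := hC_lt a a.2
  have hb : dist b x < B := hC_lt b b.2
  have ab : dist a b / 2 ≤ B := by linarith [dist_triangle_right a b x]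
  have hd : |(dist a x - dist b x) / 2| ≤ dist a b / 2 := by
    rw [abs_div, abs_two]
    exact div_le_div_of_nonneg_right (abs_dist_sub_le a b x) zero_le_two
  have hcmp := fun r hr s hs => hX.exists_compare (hC_ball a a.2) (hC_ball b b.2) (hpos a) (hpos b)
    (r := r) (s := s) hr hs
  set S := curvSin κ
  -- At the pole the angle is undefined, and `H = 0` serves.
  rcases (dist_nonneg (x := a) (y := x)).eq_or_lt with a0 | a0
  · have hax : a = x := dist_le_zero.1 a0.symm.le
    refine ⟨0, le_rfl, ?_, ?_⟩
    · rw [hax, dist_self, mul_zero, add_zero, zero_sub, neg_div, hB.neg, neg_sq, dist_comm]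
    · intro r hr s hs
      have hr0 : r = 0 := le_antisymm (a0 ▸ hr.2) hr.1
      have e1 : pos a 0 = x := Subtype.ext (hpos a).1
      have e2 : dist x (pos b s) = s := by rw [dist_comm]; exact (hpos b).dist_left hs
      rw [hr0, e1, e2, mul_zero, add_zero, zero_sub, neg_div, hB.neg, neg_sq]
  rcases (dist_nonneg (x := b) (y := x)).eq_or_lt with b0 | b0
  · have hbx : b = x := dist_le_zero.1 b0.symm.le
    refine ⟨0, le_rfl, ?_, ?_⟩
    · rw [hbx, dist_self, mul_zero, add_zero, sub_zero]
    · intro r hr s hs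
      have hs0 : s = 0 := le_antisymm (b0 ▸ hs.2) hs.1
      have e1 : pos b 0 = x := Subtype.ext (hpos b).1
      have e2 : dist (pos a r) x = r := (hpos a).dist_left hr
      rw [hs0, e1, e2, mul_zero, add_zero, sub_zero]
  have pa := hB.pos_of_pos a0 ha.le
  have pb := hB.pos_of_pos b0 hb.le
  have pab := mul_pos pa pb
  refine ⟨(S (dist a b / 2) ^ 2 - S ((dist a x - dist b x) / 2) ^ 2) /
    (S (dist a x) * S (dist b x)), ?_, ?_, ?_⟩
  · exact div_nonneg (sub_nonneg.2 (hB.sq_mono hd ab)) pab.le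
  · rw [mul_div_cancel₀ _ pab.ne']; ring
  · intro r hr s hs
    obtain ⟨l, _, h2, h3⟩ := hcmp r hr s hs
    have h4 : S (l / 2) ^ 2 - S ((r - s) / 2) ^ 2 = S r * S s *
        ((S (dist a b / 2) ^ 2 - S ((dist a x - dist b x) / 2) ^ 2) /
          (S (dist a x) * S (dist b x))) := by
      rw [mul_div_assoc', eq_div_iff pab.ne', mul_comm]
      exact h3
    have h5 : S (dist (pos a r) (pos b s) / 2) ^ 2 ≤ S (l / 2) ^ 2 := h2
    linarith

/-! ### Perturbing a nonexpansive mapping of a star -/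

theorem exists_maximal_separated {Y : Type*} [PseudoMetricSpace Y] (E : Set Y) (s : ℝ) :
    ∃ N ⊆ E, (N.Pairwise fun a b => s ≤ dist a b) ∧ ∀ y ∈ E, y ∉ N → ∃ n ∈ N, dist y n < s := by
  obtain ⟨N, hN⟩ := zorn_subset {N : Set Y | N ⊆ E ∧ N.Pairwise fun a b => s ≤ dist a b} (by
    intro c hc hchain
    refine ⟨⋃₀ c, ⟨sUnion_subset fun t ht => (hc ht).1, ?_⟩, fun t ht => subset_sUnion_of_mem ht⟩
    exact (pairwise_sUnion hchain.directedOn).2 fun t ht => (hc ht).2)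
  refine ⟨N, hN.prop.1, hN.prop.2, fun y hy hyN => ?_⟩
  by_contra! hcon
  refine hyN (hN.le_of_ge (y := insert y N) ⟨insert_subset hy hN.prop.1, ?_⟩ (subset_insert _ _)
    (mem_insert _ _))
  exact hN.prop.2.insert fun n hn _ => ⟨hcon n hn, by rw [dist_comm]; exact hcon n hn⟩

/-- The length of the part of `[0, r]` that lies in the interval `[q - h, q]`. -/
noncomputable def shellDepth (q h r : ℝ) : ℝ := max 0 (min (r - (q - h)) h)

theorem shellDepth_nonneg (q h r : ℝ) : 0 ≤ shellDepth q h r := le_max_left _ _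

theorem shellDepth_le {q h : ℝ} (hh : 0 ≤ h) (r : ℝ) : shellDepth q h r ≤ h :=
  max_le hh (min_le_right _ _)

theorem shellDepth_le_self {q h r : ℝ} (hq : h ≤ q) (hr : 0 ≤ r) : shellDepth q h r ≤ r :=
  max_le hr ((min_le_left _ _).trans (by linarith))

theorem shellDepth_sub {q h u : ℝ} (hu : 0 ≤ u) (hu' : u ≤ h) : shellDepth q h (q - u) = h - u := by
  rw [shellDepth, min_eq_left (by linarith), max_eq_right (by linarith)]
  ring

/-- Both the depth and the collapsed radius are nondecreasing in the radius, so their increments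
have the same sign and add up. -/
theorem abs_shellDepth_add_abs_le (q h r r' : ℝ) :
    |shellDepth q h r - shellDepth q h r'| +
      |(r - shellDepth q h r) - (r' - shellDepth q h r')| ≤ |r - r'| := by
  wlog hle : r' ≤ r generalizing r r'
  · have := this r' r (le_of_not_ge hle)
    rwa [abs_sub_comm (shellDepth q h r'), abs_sub_comm (r' - _), abs_sub_comm r'] at this
  have h1 : shellDepth q h r' ≤ shellDepth q h r :=
    max_le_max le_rfl (min_le_min (by linarith) le_rfl)
  have h2 : shellDepth q h r ≤ shellDepth q h r' + (r - r') := by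
    rw [shellDepth, shellDepth]
    refine max_le (by have := le_max_left 0 (min (r' - (q - h)) h); linarith) ?_
    rcases le_total (r' - (q - h)) h with h3 | h3
    · rw [min_eq_left h3]
      have := le_max_right 0 (r' - (q - h))
      exact (min_le_left _ _).trans (by linarith)
    · rw [min_eq_right h3]
      have := le_max_right 0 h
      exact (min_le_right _ _).trans (by linarith)
  rw [abs_of_nonneg (by linarith), abs_of_nonneg (by linarith), abs_of_nonneg (by linarith)]
  linarith

namespace IsRadial

variable {Y : Type*} [MetricSpace Y] {x : Y} {pos : Y → ℝ → Y} {S : ℝ → ℝ} {B : ℝ}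

/-- Moving two points inwards without widening the gap of their radii decreases both terms of the
polar formula. -/
theorem dist_pos_le (h : IsRadial x pos S B) {a b : Y} {r s : ℝ} (hr : r ∈ Icc 0 (dist a x))
    (hs : s ∈ Icc 0 (dist b x)) (hrs : |r - s| ≤ |dist a x - dist b x|) :
    dist (pos a r) (pos b s) ≤ dist a b := by
  obtain ⟨H, hH, h1, h2⟩ := h.compare a b
  have ha := h.dist_lt a
  have hb := h.dist_lt b
  have i1 : S ((r - s) / 2) ^ 2 ≤ S ((dist a x - dist b x) / 2) ^ 2 := by
    rw [← h.sine.abs_sq ((dist a x - dist b x) / 2)]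
    refine h.sine.sq_mono ?_ ?_
    · rw [abs_div, abs_div]
      exact div_le_div_of_nonneg_right hrs (abs_nonneg _)
    · rw [abs_div, abs_two]
      have h3 := abs_dist_sub_le a b x
      have h4 := h.dist_half_lt a b
      linarith
  have i2 : S r * S s * H ≤ S (dist a x) * S (dist b x) * H := by
    refine mul_le_mul_of_nonneg_right (mul_le_mul (h.sine.mono hr.1 hr.2 ha.le)
      (h.sine.mono hs.1 hs.2 hb.le) (h.sine.nonneg hs.1 (hs.2.trans hb.le))
      (h.sine.nonneg dist_nonneg ha.le)) hH
  have := h.sine.le_of_sq_le (by positivity) (h.dist_half_lt (pos a r) (pos b s)).le (by positivity)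
    (h.dist_half_lt a b).le (by rw [h1]; exact (h2 r hr s hs).trans (add_le_add i1 i2))
  linarith

end IsRadial

/-- The ray from `a` through the pole `x`, continued beyond the pole along the ray to `a₀`,
parametrized by the signed distance to the pole. -/
noncomputable def rayPoint {Y : Type*} (pos : Y → ℝ → Y) (a₀ a : Y) (w : ℝ) : Y :=
  open scoped Classical in if 0 ≤ w then pos a w else pos a₀ (-w)

namespace IsRadial

variable {Y : Type*} [MetricSpace Y] {x : Y} {pos : Y → ℝ → Y} {S : ℝ → ℝ} {B : ℝ}

theorem dist_rayPoint_pole (h : IsRadial x pos S B) {a₀ a : Y} {w : ℝ} (h₀ : -dist a₀ x ≤ w)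
    (h₁ : w ≤ dist a x) : dist (rayPoint pos a₀ a w) x = |w| := by
  by_cases h0 : 0 ≤ w
  · rw [rayPoint, if_pos h0, h.dist_pos_pole a ⟨h0, h₁⟩, abs_of_nonneg h0]
  · rw [rayPoint, if_neg h0, h.dist_pos_pole a₀ ⟨by linarith, by linarith⟩,
      abs_of_neg (not_le.1 h0)]

/-- The heights `v`, `v'` in the angle term are upper bounds for `w`, `w'`, so a lowering of heights
and a crossing of the pole cost nothing there. -/
theorem sq_dist_rayPoint_le (h : IsRadial x pos S B) {a₀ a b : Y} {H w w' v v' : ℝ} (hH : 0 ≤ H)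
    (hab : ∀ r ∈ Icc 0 (dist a x), ∀ s ∈ Icc 0 (dist b x),
      S (dist (pos a r) (pos b s) / 2) ^ 2 ≤ S ((r - s) / 2) ^ 2 + S r * S s * H)
    (h₀ : -dist a₀ x ≤ w) (h₀' : -dist a₀ x ≤ w') (hwv : w ≤ v) (hwv' : w' ≤ v')
    (hv : v ∈ Icc 0 (dist a x)) (hv' : v' ∈ Icc 0 (dist b x)) :
    S (dist (rayPoint pos a₀ a w) (rayPoint pos a₀ b w') / 2) ^ 2 ≤
      S ((w - w') / 2) ^ 2 + S v * S v' * H := by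
  have ha := h.dist_lt a
  have hb := h.dist_lt b
  have ha₀ := h.dist_lt a₀
  have nv := h.sine.nonneg hv.1 (hv.2.trans ha.le)
  have nv' := h.sine.nonneg hv'.1 (hv'.2.trans hb.le)
  have hT : 0 ≤ S v * S v' * H := mul_nonneg (mul_nonneg nv nv') hH
  by_cases hw : 0 ≤ w ∧ 0 ≤ w'
  · rw [rayPoint, rayPoint, if_pos hw.1, if_pos hw.2]
    refine (hab w ⟨hw.1, hwv.trans hv.2⟩ w' ⟨hw.2, hwv'.trans hv'.2⟩).trans ?_
    refine add_le_add le_rfl (mul_le_mul_of_nonneg_right ?_ hH)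
    exact mul_le_mul (h.sine.mono hw.1 hwv (hv.2.trans ha.le))
      (h.sine.mono hw.2 hwv' (hv'.2.trans hb.le))
      (h.sine.nonneg hw.2 (hwv'.trans (hv'.2.trans hb.le))) nv
  -- Once a point has crossed the pole, the angle term is not needed: both points lie on the ray to
  -- `a₀`, or the path through the pole has length `|w - w'|`.
  · have key : dist (rayPoint pos a₀ a w) (rayPoint pos a₀ b w') ≤ |w - w'| := by
      by_cases hw2 : w < 0 ∧ w' < 0
      · rw [rayPoint, rayPoint, if_neg hw2.1.not_ge, if_neg hw2.2.not_ge,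
          h.dist_pos a₀ _ ⟨by linarith, by linarith⟩ _ ⟨by linarith, by linarith⟩, abs_sub_comm]
        refine le_of_eq (congrArg _ (by ring))
      · refine (dist_triangle_right _ _ x).trans ?_
        rw [h.dist_rayPoint_pole h₀ (hwv.trans hv.2), h.dist_rayPoint_pole h₀' (hwv'.trans hv'.2)]
        rcases lt_or_ge w 0 with h1 | h1
        · have h2 : 0 ≤ w' := by by_contra! h2; exact hw2 ⟨h1, h2⟩
          rw [abs_of_neg h1, abs_of_nonneg h2, abs_sub_comm, abs_of_nonneg (by linarith)]
          linarith
        · have h2 : w' < 0 := by by_contra! h2; exact hw ⟨h1, h2⟩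
          rw [abs_of_nonneg h1, abs_of_neg h2, abs_of_nonneg (by linarith)]
          linarith
    have : S (dist (rayPoint pos a₀ a w) (rayPoint pos a₀ b w') / 2) ^ 2 ≤
        S ((w - w') / 2) ^ 2 := by
      rw [← h.sine.abs_sq ((w - w') / 2), abs_div, abs_two]
      refine h.sine.sq_mono ?_ ?_
      · rw [abs_of_nonneg (by positivity)]
        linarith
      · have : |w - w'| ≤ 2 * B := by
          rw [abs_le]
          constructor <;> linarith [hv.2, hv'.2]
        linarith
    linarith

theorem dist_rayPoint_le_abs_sub (h : IsRadial x pos S B) {a₀ a : Y} {w v : ℝ}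
    (h₀ : -dist a₀ x ≤ w) (hwv : w ≤ v) (hv : v ∈ Icc 0 (dist a x)) :
    dist (rayPoint pos a₀ a w) (pos a v) ≤ v - w := by
  by_cases hw : 0 ≤ w
  · rw [rayPoint, if_pos hw, h.dist_pos a w ⟨hw, hwv.trans hv.2⟩ v hv, abs_sub_comm,
      abs_of_nonneg (by linarith)]
  · refine (dist_triangle_right _ _ x).trans ?_
    rw [h.dist_rayPoint_pole h₀ (hwv.trans hv.2), h.dist_pos_pole a hv, abs_of_neg (not_le.1 hw)]
    linarith

/-- The collapse of the shell of radii `[q - h, q]`. -/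
theorem dist_collapse_le (h : IsRadial x pos S B) {q l : ℝ} (hq : l ≤ q) (y z : Y) :
    dist (pos y (dist y x - shellDepth q l (dist y x)))
      (pos z (dist z x - shellDepth q l (dist z x))) ≤ dist y z := by
  have e := fun y : Y => shellDepth_le_self (r := dist y x) hq dist_nonneg
  have e' := fun y : Y => shellDepth_nonneg q l (dist y x)
  refine h.dist_pos_le ⟨sub_nonneg.2 (e y), by linarith [e' y]⟩
    ⟨sub_nonneg.2 (e z), by linarith [e' z]⟩ ?_
  have := abs_shellDepth_add_abs_le q l (dist y x) (dist z x)
  linarith [abs_nonneg (shellDepth q l (dist y x) - shellDepth q l (dist z x))]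

/-- The collapse of a shell leaves room for a function of the radius that varies in the shell. -/
theorem shellDepth_sq_add_le (h : IsRadial x pos S B) {q l : ℝ} (hq : l ≤ q) (y z : Y) :
    S ((shellDepth q l (dist y x) - shellDepth q l (dist z x)) / 2) ^ 2 +
      S (dist (pos y (dist y x - shellDepth q l (dist y x)))
        (pos z (dist z x - shellDepth q l (dist z x))) / 2) ^ 2 ≤ S (dist y z / 2) ^ 2 := by
  obtain ⟨H, hH, h1, h2⟩ := h.compare y z
  have hy := h.dist_lt y
  have hz := h.dist_lt z
  have e := fun y : Y => shellDepth_le_self (r := dist y x) hq dist_nonneg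
  have e' := fun y : Y => shellDepth_nonneg q l (dist y x)
  have h3 := h2 _ ⟨sub_nonneg.2 (e y), by linarith [e' y]⟩ _
    ⟨sub_nonneg.2 (e z), by linarith [e' z]⟩
  have h4 := abs_shellDepth_add_abs_le q l (dist y x) (dist z x)
  have y0 : 0 ≤ dist y x := dist_nonneg
  have z0 : 0 ≤ dist z x := dist_nonneg
  have hyz : |dist y x - dist z x| ≤ B := by rw [abs_le]; constructor <;> linarith
  have m1 := h.sine.mono (sub_nonneg.2 (e y)) (by linarith [e' y]) hy.le
  have m2 := h.sine.mono (sub_nonneg.2 (e z)) (by linarith [e' z]) hz.le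
  have n2 := h.sine.nonneg (sub_nonneg.2 (e z)) (by linarith [e' z])
  have n1 := h.sine.nonneg y0 hy.le
  have h5 := mul_le_mul_of_nonneg_right (mul_le_mul m1 m2 n2 n1) hH
  generalize shellDepth q l (dist y x) = p at *
  generalize shellDepth q l (dist z x) = p' at *
  have h6 : S ((p - p') / 2) ^ 2 + S ((dist y x - p - (dist z x - p')) / 2) ^ 2 ≤
      S ((dist y x - dist z x) / 2) ^ 2 := by
    rw [← h.sine.abs_sq, ← h.sine.abs_sq ((dist y x - p - (dist z x - p')) / 2),
      ← h.sine.abs_sq ((dist y x - dist z x) / 2), abs_div, abs_div, abs_div, abs_two]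
    -- The increments of depth and of collapsed radius share the increment of the radius;
    -- superadditivity of `S ^ 2` splits the budget.
    refine (h.sine.superadd _ _ (by positivity) (by positivity) (by linarith)).trans ?_
    refine h.sine.sq_mono ?_ (by linarith [h.sine.pos])
    rw [abs_of_nonneg (by positivity)]
    linarith
  linarith

/-- The three ways in which the height `w` may vary without making `rayPoint` expansive. -/
theorem dist_rayPoint_le (h : IsRadial x pos S B) {a₀ : Y} {q l : ℝ} (hq : l ≤ q)
    {f : Y → Y} (hf : ∀ y z, dist (f y) (f z) ≤ dist y z) {R c e : ℝ} (hc1 : c ≤ 1)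
    (he1 : e ≤ 1)
    (hc : ∀ u ∈ Icc 0 R, ∀ t ∈ Icc (0 : ℝ) 1, S ((1 - t) * u) ≤ (1 - c * t) * S u)
    (hslack : ∀ t ∈ Icc (0 : ℝ) 1, ∀ δ P, 0 ≤ δ → δ ≤ B / 2 → δ ≤ P → P ≤ B →
        S ((1 - t) * δ + e * t * P) ^ 2 ≤ (1 - c * t) * S δ ^ 2 + c * t * S P ^ 2)
    {t : ℝ} (ht : t ∈ Icc (0 : ℝ) 1) {y z a b : Y}
    (ha : a = f (pos y (dist y x - shellDepth q l (dist y x))))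
    (hb : b = f (pos z (dist z x - shellDepth q l (dist z x)))) {w w' : ℝ}
    (h₀ : -dist a₀ x ≤ w) (h₀' : -dist a₀ x ≤ w') (hw : w ≤ (1 - t) * dist a x)
    (hw' : w' ≤ (1 - t) * dist b x) (hww : w' ≤ w)
    (hcases : w - w' ≤ |(1 - t) * dist a x - (1 - t) * dist b x| ∨
      w - w' ≤ |shellDepth q l (dist y x) - shellDepth q l (dist z x)| ∨
      (dist a x ≤ R ∧ w - w' ≤ |(1 - t) * dist a x - (1 - t) * dist b x| + e * t * dist y z)) :
    dist (rayPoint pos a₀ a w) (rayPoint pos a₀ b w') ≤ dist y z := by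
  obtain ⟨H, hH, h1, h2⟩ := h.compare a b
  have hψ := h.dist_collapse_le hq y z
  have hsh := h.shellDepth_sq_add_le hq y z
  have hfψ := hf (pos y (dist y x - shellDepth q l (dist y x)))
    (pos z (dist z x - shellDepth q l (dist z x)))
  rw [← ha, ← hb] at hfψ
  have haB := h.dist_lt a
  have hbB := h.dist_lt b
  have a0 : 0 ≤ dist a x := dist_nonneg
  have b0 : 0 ≤ dist b x := dist_nonneg
  have t0 : 0 ≤ 1 - t := sub_nonneg.2 ht.2
  have va : (1 - t) * dist a x ∈ Icc 0 (dist a x) :=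
    ⟨mul_nonneg t0 a0, mul_le_of_le_one_left a0 (by linarith [ht.1])⟩
  have vb : (1 - t) * dist b x ∈ Icc 0 (dist b x) :=
    ⟨mul_nonneg t0 b0, mul_le_of_le_one_left b0 (by linarith [ht.1])⟩
  have hyzB := (h.dist_half_lt y z).le
  have hfin := h.sq_dist_rayPoint_le (a₀ := a₀) hH h2 h₀ h₀' hw hw' va vb
  have Sa := h.sine.mono va.1 va.2 haB.le
  have Sb := h.sine.mono vb.1 vb.2 hbB.le
  have nSa := h.sine.nonneg a0 haB.le
  have nSb := h.sine.nonneg b0 hbB.le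
  have nSb' := h.sine.nonneg vb.1 (vb.2.trans hbB.le)
  have hT : S ((1 - t) * dist a x) * S ((1 - t) * dist b x) * H ≤
      S (dist a x) * S (dist b x) * H :=
    mul_le_mul_of_nonneg_right (mul_le_mul Sa Sb nSb' nSa) hH
  have hT0 : 0 ≤ S (dist a x) * S (dist b x) * H := by positivity
  have hdab : S (dist a b / 2) ^ 2 ≤ S (dist (pos y (dist y x - shellDepth q l (dist y x)))
        (pos z (dist z x - shellDepth q l (dist z x))) / 2) ^ 2 := by
    refine h.sine.sq_mono ?_ (h.dist_half_lt _ _).le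
    rw [abs_of_nonneg (by positivity)]; linarith
  have hdyz : S (dist a b / 2) ^ 2 ≤ S (dist y z / 2) ^ 2 := by
    refine h.sine.sq_mono ?_ hyzB
    rw [abs_of_nonneg (by positivity)]; linarith
  have hww0 : 0 ≤ (w - w') / 2 := by linarith
  have habs : |dist a x - dist b x| ≤ dist a b := abs_dist_sub_le a b x
  have hΔB : |dist a x - dist b x| ≤ B := by rw [abs_le]; constructor <;> linarith
  have hΔ0 := abs_nonneg (dist a x - dist b x)
  have eΔ : |(1 - t) * dist a x - (1 - t) * dist b x| = (1 - t) * |dist a x - dist b x| := by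
    rw [← mul_sub, abs_mul, abs_of_nonneg t0]
  have eS : S ((dist a x - dist b x) / 2) ^ 2 = S (|dist a x - dist b x| / 2) ^ 2 := by
    rw [← h.sine.abs_sq, abs_div, abs_two]
  rw [eΔ] at hcases
  suffices hsuff : S ((w - w') / 2) ^ 2 + S ((1 - t) * dist a x) * S ((1 - t) * dist b x) * H ≤
      S (dist y z / 2) ^ 2 by
    have := h.sine.le_of_sq_le (by positivity) (h.dist_half_lt _ _).le (by positivity) hyzB
      (hfin.trans hsuff)
    linarith
  rcases hcases with hcase | hcase | ⟨hR, hcase⟩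
  · have : S ((w - w') / 2) ^ 2 ≤ S (|dist a x - dist b x| / 2) ^ 2 := by
      refine h.sine.sq_mono ?_ (by linarith)
      rw [abs_of_nonneg hww0]
      have := mul_le_of_le_one_left hΔ0 (by linarith [ht.1] : 1 - t ≤ 1)
      linarith
    linarith
  -- The height variation is paid for by the collapse of the shell.
  · have : S ((w - w') / 2) ^ 2 ≤
        S ((shellDepth q l (dist y x) - shellDepth q l (dist z x)) / 2) ^ 2 := by
      rw [← h.sine.abs_sq ((shellDepth q l (dist y x) - shellDepth q l (dist z x)) / 2), abs_div,
        abs_two]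
      refine h.sine.sq_mono ?_ ?_
      · rw [abs_of_nonneg hww0]; linarith
      · have i1 := abs_shellDepth_add_abs_le q l (dist y x) (dist z x)
        have i2 := abs_dist_sub_le y z x
        have i3 := abs_nonneg (dist y x - shellDepth q l (dist y x) -
          (dist z x - shellDepth q l (dist z x)))
        linarith
    have i3 := sq_nonneg (S ((dist a x - dist b x) / 2))
    linarith
  -- The extra slope `e * t` is paid for by the contraction: both the radial and the angular term
  -- lose the proportion `c * t`.
  · have hP : |dist a x - dist b x| / 2 ≤ dist y z / 2 := by linarith
    have k1 := hslack t ht (|dist a x - dist b x| / 2) (dist y z / 2) (by positivity) (by linarith)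
      hP hyzB
    have hD : (w - w') / 2 ≤ (1 - t) * (|dist a x - dist b x| / 2) + e * t * (dist y z / 2) := by
      linarith
    have hct : 0 ≤ 1 - c * t := by
      have := mul_le_one₀ hc1 ht.1 ht.2
      linarith
    have k2 : S ((1 - t) * dist a x) * S ((1 - t) * dist b x) * H ≤
        (1 - c * t) * (S (dist a x) * S (dist b x) * H) := by
      have := mul_le_mul_of_nonneg_right (mul_le_mul (hc _ ⟨a0, hR⟩ t ht) Sb nSb'
        (mul_nonneg hct nSa)) hH
      linarith
    have k3 : S (|dist a x - dist b x| / 2) ^ 2 + S (dist a x) * S (dist b x) * H ≤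
        S (dist y z / 2) ^ 2 := by linarith
    have k4 := mul_le_mul_of_nonneg_left k3 hct
    have hB : (1 - t) * (|dist a x - dist b x| / 2) + e * t * (dist y z / 2) ≤ B := by
      have i1 := mul_le_mul_of_nonneg_left hP t0
      have i2 : e * t * (dist y z / 2) ≤ t * (dist y z / 2) := by
        refine mul_le_mul_of_nonneg_right ?_ (by positivity)
        exact mul_le_of_le_one_left ht.1 he1
      linarith
    have : S ((w - w') / 2) ^ 2 ≤
        S ((1 - t) * (|dist a x - dist b x| / 2) + e * t * (dist y z / 2)) ^ 2 := by
      refine h.sine.sq_mono ?_ hB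
      rwa [abs_of_nonneg hww0]
    linarith

end IsRadial

/-- `w` is the maximum of the base level `v - η * (s / 4)` and of the bumps `min (v - η * dist · n)
(A n ·)`. A bump exceeds the base level only within `s / 4` of its centre, so by separation at most
one is active at each point. -/
theorem exists_height {Y : Type*} [PseudoMetricSpace Y] {N : Set Y} {s η : ℝ} (hs : 0 ≤ s) (hη : 0 ≤ η)
    (hN : N.Pairwise fun a b => s / 2 ≤ dist a b) (v : Y → ℝ) (A : Y → Y → ℝ) :
    ∃ w : Y → ℝ, (∀ y, v y - η * (s / 4) ≤ w y) ∧ (∀ y, w y ≤ v y) ∧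
      (∀ y, ∀ n ∈ N, min (v y - η * dist y n) (A n y) ≤ w y) ∧
      ∀ y, w y = v y - η * (s / 4) ∨
        ∃ n ∈ N, dist y n < s / 4 ∧ w y = min (v y - η * dist y n) (A n y) := by
  have key : ∀ y, ∃ w : ℝ, v y - η * (s / 4) ≤ w ∧ (∀ n ∈ N,
      min (v y - η * dist y n) (A n y) ≤ w) ∧ (w = v y - η * (s / 4) ∨
        ∃ n ∈ N, dist y n < s / 4 ∧ w = min (v y - η * dist y n) (A n y)) := by
    intro y
    by_cases hy : ∃ n ∈ N, v y - η * (s / 4) < min (v y - η * dist y n) (A n y)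
    · obtain ⟨n, hn, hlt⟩ := hy
      have near : ∀ n, v y - η * (s / 4) < min (v y - η * dist y n) (A n y) → dist y n < s / 4 := by
        intro n hlt
        by_contra! hle
        have := mul_le_mul_of_nonneg_left hle hη
        linarith [hlt.trans_le (min_le_left _ _)]
      refine ⟨_, hlt.le, fun n' hn' => ?_, Or.inr ⟨n, hn, near n hlt, rfl⟩⟩
      by_contra! hlt'
      have h1 := near n hlt
      have h2 := near n' (hlt.trans hlt')
      have hne : n ≠ n' := by rintro rfl; exact lt_irrefl _ hlt'
      linarith [hN hn hn' hne, dist_triangle_left n n' y]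
    · push Not at hy
      exact ⟨_, le_rfl, hy, Or.inl rfl⟩
  choose w h1 h2 h3 using key
  refine ⟨w, h1, fun y => ?_, h2, h3⟩
  rcases h3 y with h | ⟨n, _, hn, h⟩
  · have := mul_nonneg hη (div_nonneg hs zero_le_four)
    linarith
  · rw [h]
    have := mul_nonneg hη (dist_nonneg (x := y) (y := n))
    exact (min_le_left _ _).trans (by linarith)

namespace IsRadial

variable {Y : Type*} [MetricSpace Y] {x : Y} {pos : Y → ℝ → Y} {S : ℝ → ℝ} {B : ℝ}

/-- Every nonexpansive mapping of a star is close to one that moves some pairs of points,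
at a distance comparable to that of the mappings, without contracting them. -/
theorem exists_perturbation (h : IsRadial x pos S B) {a₀ : Y} (ha₀ : a₀ ≠ x) {q s : ℝ}
    (hq : 0 < q) (hs : 0 < s) :
    ∃ t₀ > 0, ∃ β > 0, ∀ t, 0 < t → t ≤ t₀ → ∀ f : Y → Y,
      (∀ y z, dist (f y) (f z) ≤ dist y z) →
      ∃ g : Y → Y, (∀ y z, dist (g y) (g z) ≤ dist y z) ∧
        (∀ y, dist (g y) (f y) ≤ (B + s) * t) ∧
        ∀ y₀, dist y₀ x = q → dist (f y₀) x ≤ B - s →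
          ∃ y ∈ ball y₀ s, ∃ z ∈ ball y₀ s, dist y z = β * t ∧ dist (g y) (g z) = β * t := by
  have hB := h.sine.pos
  obtain ⟨c, hc0, hc1, e, he0, he1, hc, hslack⟩ := h.sine.exists_slack (R := B - s / 2) (by linarith)
  have ha₀' : 0 < dist a₀ x := _root_.dist_pos.2 ha₀
  -- The bounds on `t` give `l ≤ q`, so that the shell fits around the pole, and `l ≤ dist a₀ x`, so
  -- that heights may drop by `l` below zero. The preserved distance `β * t` is `l / 2`.
  refine ⟨min 1 (min (q / (e * (s / 4))) (dist a₀ x / (e * (s / 4)))),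
    lt_min one_pos (lt_min (by positivity) (by positivity)), e * (s / 4) / 2, by positivity, ?_⟩
  intro t ht0 ht f hf
  have ht1 : t ≤ 1 := ht.trans (min_le_left _ _)
  set l := e * t * (s / 4) with hl
  have hl0 : 0 < l := by positivity
  have hlq : l ≤ q := by
    have := ht.trans ((min_le_right _ _).trans (min_le_left _ _))
    rw [le_div_iff₀ (by positivity)] at this
    rw [hl]; linarith
  have hla : l ≤ dist a₀ x := by
    have := ht.trans ((min_le_right _ _).trans (min_le_right _ _))
    rw [le_div_iff₀ (by positivity)] at this
    rw [hl]; linarith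
  have het : e * t ≤ t := mul_le_of_le_one_left ht0.le he1
  have het1 : e * t ≤ 1 := het.trans ht1
  have hls : l ≤ t * (s / 4) := mul_le_mul_of_nonneg_right het (by positivity)
  have hls4 : l ≤ s / 4 := hls.trans (mul_le_of_le_one_left (by positivity) ht1)
  set ψ : Y → Y := fun y => pos y (dist y x - shellDepth q l (dist y x)) with hψ
  have hψ1 : ∀ y z, dist (ψ y) (ψ z) ≤ dist y z := fun y z => h.dist_collapse_le hlq y z
  have hmem : ∀ y, dist y x - shellDepth q l (dist y x) ∈ Icc 0 (dist y x) := fun y =>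
    ⟨sub_nonneg.2 (shellDepth_le_self hlq dist_nonneg), by
      linarith [shellDepth_nonneg q l (dist y x)]⟩
  have hψd : ∀ y, dist (ψ y) y ≤ l := by
    intro y
    rw [hψ, h.dist_pos_self y (hmem y), sub_sub_cancel]
    exact shellDepth_le hl0.le _
  set v : Y → ℝ := fun y => (1 - t) * dist (f (ψ y)) x with hv
  have hv0 : ∀ y, 0 ≤ v y := fun y => mul_nonneg (by linarith) dist_nonneg
  have hv1 : ∀ y, v y ≤ dist (f (ψ y)) x := fun y =>
    mul_le_of_le_one_left dist_nonneg (by linarith)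
  obtain ⟨N, hNE, hN, hNmax⟩ :=
    exists_maximal_separated {y | dist y x = q ∧ dist (f y) x ≤ B - s} (s / 2)
  -- Slope `e * t` makes the base level `v - l`; the bump at `n` is capped by a function of the
  -- depth in the shell alone.
  obtain ⟨w, hw1, hw2, hw3, hw4⟩ := exists_height (η := e * t) hs.le (by positivity) hN v
    (fun n y => v n - l + shellDepth q l (dist y x))
  rw [← hl] at hw1 hw4
  have hwa : ∀ y, -dist a₀ x ≤ w y := fun y => by linarith [hw1 y, hv0 y]
  set g : Y → Y := fun y => rayPoint pos a₀ (f (ψ y)) (w y) with hg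
  refine ⟨g, ?_, ?_, ?_⟩
  · have key : ∀ y z, w z ≤ w y → dist (g y) (g z) ≤ dist y z := by
      intro y z hzy
      refine h.dist_rayPoint_le hlq hf hc1 he1 hc hslack ⟨ht0.le, ht1⟩ rfl rfl (hwa y) (hwa z)
        (hw2 y) (hw2 z) hzy ?_
      rcases hw4 y with hy | ⟨n, hn, hyn, hy⟩
      · left
        refine le_trans ?_ (le_abs_self (v y - v z))
        linarith [hw1 z]
      · rcases min_le_iff.1 (hw3 z n hn) with hz | hz
        · right; right
          constructor
          -- An active bump puts `y` within `s / 4` of `n`, whose image has radius at most `B - s`;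
          -- this accounts for `R = B - s / 2`.
          · have h1 := hf (ψ y) n
            have h2 := hψ1 y n
            have h3 := hψd n
            have h4 := (hNE hn).2
            have h5 := dist_triangle (f (ψ y)) (f n) x
            have h6 := dist_triangle (ψ y) (ψ n) n
            linarith
          · refine le_trans ?_ (add_le_add (le_abs_self (v y - v z)) le_rfl)
            have h1 : w y ≤ v y - e * t * dist y n := hy ▸ min_le_left _ _
            have h2 := mul_le_mul_of_nonneg_left (dist_triangle_left z n y)
              (by positivity : 0 ≤ e * t)
            linarith
        · right; left
          refine le_trans ?_ (le_abs_self _)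
          have h1 : w y ≤ v n - l + shellDepth q l (dist y x) := hy ▸ min_le_right _ _
          linarith
    intro y z
    rcases le_total (w z) (w y) with hzy | hzy
    · exact key y z hzy
    · rw [dist_comm, dist_comm y z]; exact key z y hzy
  · intro y
    have h1 := h.dist_rayPoint_le_abs_sub (hwa y) (hw2 y) ⟨hv0 y, hv1 y⟩
    have h2 := h.dist_pos_self (f (ψ y)) ⟨hv0 y, hv1 y⟩
    have h3 := (hf (ψ y) y).trans (hψd y)
    have h4 := dist_triangle4 (g y) (pos (f (ψ y)) (v y)) (f (ψ y)) (f y)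
    have h5 : dist (f (ψ y)) x - v y ≤ B * t := by
      have := mul_le_mul_of_nonneg_left (h.dist_lt (f (ψ y))).le ht0.le
      simp only [hv]; linarith
    have h6 : 0 ≤ t * s := by positivity
    have h7 : dist (g y) (pos (f (ψ y)) (v y)) ≤ l := h1.trans (by linarith [hw1 y])
    linarith
  · intro y₀ hy₀ hfy₀
    obtain ⟨n, hn, hyn⟩ : ∃ n ∈ N, dist y₀ n < s / 2 := by
      by_cases hmemN : y₀ ∈ N
      · exact ⟨y₀, hmemN, by rw [dist_self]; positivity⟩
      · exact hNmax y₀ ⟨hy₀, hfy₀⟩ hmemN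
    have hnq : dist n x = q := (hNE hn).1
    have hI : ∀ {σ : ℝ}, σ ∈ Icc 0 l → q - σ ∈ Icc 0 (dist n x) := fun hσ =>
      ⟨by linarith [hσ.2], by linarith [hσ.1]⟩
    have hrad : ∀ {σ : ℝ}, σ ∈ Icc 0 l → dist (pos n (q - σ)) x = q - σ := fun hσ =>
      h.dist_pos_pole n (hI hσ)
    have hdist : ∀ {σ : ℝ}, σ ∈ Icc 0 l → dist (pos n (q - σ)) n = σ := fun {σ} hσ => by
      rw [h.dist_pos_self n (hI hσ), hnq]; ring
    have hψeq : ∀ {σ : ℝ}, σ ∈ Icc 0 l → ψ (pos n (q - σ)) = pos n (q - l) := fun {σ} hσ => by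
      simp only [hψ]
      rw [hrad hσ, shellDepth_sub hσ.1 hσ.2, h.pos_pos n (hI hσ) ⟨by linarith, by linarith [hσ.2]⟩]
      congr 1; ring
    have hn0 : pos n (q - 0) = n := by rw [sub_zero, ← hnq, h.pos_self]
    have hψn : ψ n = pos n (q - l) := by
      have := hψeq (σ := 0) ⟨le_rfl, hl0.le⟩
      rwa [hn0] at this
    have hveq : ∀ {σ : ℝ}, σ ∈ Icc 0 l → v (pos n (q - σ)) = v n := fun hσ => by
      simp only [hv]
      rw [hψeq hσ, hψn]
    have hweq : ∀ {σ : ℝ}, σ ∈ Icc 0 l → w (pos n (q - σ)) = v n - σ := fun {σ} hσ => by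
      -- Along the segment the cap is the smaller term, since `e * t ≤ 1`; it decreases at unit
      -- speed.
      have hmin : min (v (pos n (q - σ)) - e * t * dist (pos n (q - σ)) n)
          (v n - l + shellDepth q l (dist (pos n (q - σ)) x)) = v n - σ := by
        rw [hveq hσ, hdist hσ, hrad hσ, shellDepth_sub hσ.1 hσ.2, min_eq_right]
        · ring
        · have := mul_le_of_le_one_left hσ.1 het1
          linarith
      refine le_antisymm ?_ (hmin ▸ hw3 _ n hn)
      rcases hw4 (pos n (q - σ)) with h1 | ⟨n', hn', h1, h2⟩
      · rw [h1, hveq hσ]; linarith [hσ.2]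
      · have : n = n' := by
          by_contra hne
          have h3 := hN hn hn' hne
          have h4 := dist_triangle_left n n' (pos n (q - σ))
          rw [hdist hσ] at h4
          linarith [hσ.2]
        subst this
        rw [h2, hmin]
    have hgeq : ∀ {σ : ℝ}, σ ∈ Icc 0 l →
        g (pos n (q - σ)) = rayPoint pos a₀ (f (ψ n)) (v n - σ) := fun {σ} hσ => by
      simp only [hg]
      rw [hweq hσ, hψeq hσ, hψn]
    have hball : ∀ {σ : ℝ}, σ ∈ Icc 0 l → pos n (q - σ) ∈ ball y₀ s := fun {σ} hσ => by
      rw [mem_ball]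
      have h1 := dist_triangle (pos n (q - σ)) n y₀
      rw [hdist hσ, dist_comm n y₀] at h1
      linarith [hσ.2]
    have hβ : e * (s / 4) / 2 * t = l / 2 := by rw [hl]; ring
    have m0 : (0 : ℝ) ∈ Icc 0 l := ⟨le_rfl, hl0.le⟩
    have m1 : l / 2 ∈ Icc 0 l := ⟨by linarith, by linarith⟩
    have m2 : l ∈ Icc 0 l := ⟨hl0.le, le_rfl⟩
    have hpair : ∀ {σ τ : ℝ}, σ ∈ Icc 0 l → τ ∈ Icc 0 l → τ - σ = l / 2 →
        dist (rayPoint pos a₀ (f (ψ n)) (v n - σ)) (rayPoint pos a₀ (f (ψ n)) (v n - τ)) = l / 2 →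
        ∃ y ∈ ball y₀ s, ∃ z ∈ ball y₀ s, dist y z = e * (s / 4) / 2 * t ∧
          dist (g y) (g z) = e * (s / 4) / 2 * t := by
      intro σ τ hσ hτ hστ hd
      refine ⟨_, hball hσ, _, hball hτ, ?_, ?_⟩
      · rw [hβ, h.dist_pos n _ (hI hσ) _ (hI hτ), ← hστ, abs_of_nonneg (by linarith)]
        ring
      · rw [hgeq hσ, hgeq hτ, hd, hβ]
    have hvn0 := hv0 n
    have hvn1 := hv1 n
    -- The concatenated ray need not be geodesic at the pole, so the half of `[0, l]` is taken on
    -- which the height `v n - σ` does not change sign.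
    rcases le_or_gt (l / 2) (v n) with hcase | hcase
    · refine hpair m0 m1 (by ring) ?_
      rw [rayPoint, rayPoint, if_pos (by linarith), if_pos (by linarith),
        h.dist_pos _ _ ⟨by linarith, by linarith⟩ _ ⟨by linarith, by linarith⟩,
        abs_of_nonneg (by linarith)]
      ring
    · refine hpair m1 m2 (by ring) ?_
      rw [rayPoint, rayPoint, if_neg (by linarith), if_neg (by linarith),
        h.dist_pos _ _ ⟨by linarith, by linarith⟩ _ ⟨by linarith, by linarith⟩,
        abs_of_nonpos (by linarith)]
      ring

end IsRadial

/-! ### Porosity of the exceptional sets and residuality -/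

/-- The nonexpansive mappings `f` of `C` that are `L`-Lipschitz on the ball of radius `s` around
some point `y₀` at distance `q` from `x`, with `f y₀` at distance at most `B - 2 s` from `x`. -/
def locallyContractiveMaps {X : Type*} [MetricSpace X] {C : Set X} (x : C) (B q s L : ℝ) :
    Set (NonexpansiveMap C) :=
  {f | ∃ y₀ : C, dist y₀ x = q ∧ dist (f.1 y₀) x ≤ B - 2 * s ∧
    ∀ y ∈ ball y₀ s, ∀ z ∈ ball y₀ s, dist (f.1 y) (f.1 z) ≤ L * dist y z}

theorem IsRadial.isPorous_locallyContractiveMaps {X : Type*} [MetricSpace X] {C : Set X} {x : C}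
    {pos : C → ℝ → C} {S : ℝ → ℝ} {B : ℝ} (h : IsRadial x pos S B) {a₀ : C} (ha₀ : a₀ ≠ x)
    {q s L : ℝ} (hq : 0 < q) (hs : 0 < s) (hL : L < 1) :
    IsPorous (locallyContractiveMaps x B q s L) := by
  intro f _
  have hB := h.sine.pos
  obtain ⟨t₀, ht₀, β, hβ, H⟩ := h.exists_perturbation ha₀ hq hs
  have hL' : 0 < 1 - L := by linarith
  set α := (1 - L) * β / (8 * (B + s)) with hα
  have hα0 : 0 < α := by positivity
  -- The first bound gives `t ≤ t₀`. The second keeps `f y₀` within `B - s` of the pole when `k y₀`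
  -- is within `B - 2 * s`, as `f` and `k` differ by at most `ε / 2 + α * ε`.
  refine ⟨min (2 * (B + s) * t₀) (s / (α + 1 / 2)), by positivity, α, hα0, fun ε hε hε₀ => ?_⟩
  have hε1 : ε ≤ 2 * (B + s) * t₀ := hε₀.le.trans (min_le_left _ _)
  have hε2 : (α + 1 / 2) * ε ≤ s := by
    have := hε₀.le.trans (min_le_right _ _)
    rw [le_div_iff₀ (by positivity)] at this
    linarith
  set t := ε / (2 * (B + s)) with ht
  have htε : (B + s) * t = ε / 2 := by rw [ht]; field_simp
  -- Passing from `g` to `k` costs at most `2 * α * ε` on the preserved pair, half of the gap `(1 -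
  -- L) * (β * t)`.
  have hβt : (1 - L) * (β * t) = 4 * (α * ε) := by rw [ht, hα]; field_simp; ring
  have hf : ∀ y z, dist (f.1 y) (f.1 z) ≤ dist y z := fun y z => by
    simpa using f.2.dist_le_mul y z
  obtain ⟨g, hg, hgf, hgy⟩ := H t (by positivity)
    (by rw [ht, div_le_iff₀ (by positivity)]; linarith) f.1 hf
  have hgL : LipschitzWith 1 g := LipschitzWith.of_dist_le_mul fun y z => by simpa using hg y z
  refine ⟨⟨BoundedContinuousFunction.mkOfBound ⟨g, hgL.continuous⟩ (2 * B) fun y z => ?_, hgL⟩,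
    ?_, ?_⟩
  · change dist (g y) (g z) ≤ 2 * B
    linarith [h.dist_half_lt (g y) (g z)]
  · rw [mem_ball]
    refine lt_of_le_of_lt ((BoundedContinuousFunction.dist_le (by positivity)).2 hgf) ?_
    linarith
  · rw [eq_empty_iff_forall_notMem]
    rintro k ⟨hkg, y₀, hy₀, hky₀, hk⟩
    have hkg' : ∀ y, dist (k.1 y) (g y) < α * ε := fun y =>
      (BoundedContinuousFunction.dist_coe_le_dist (f := k.1) y).trans_lt hkg
    obtain ⟨y, hy, z, hz, hyz, hgyz⟩ := hgy y₀ hy₀ (by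
      have h1 := dist_triangle4 (f.1 y₀) (g y₀) (k.1 y₀) x
      have h2 := hgf y₀
      have h3 := hkg' y₀
      rw [dist_comm] at h2 h3
      linarith)
    have h1 := hk y hy z hz
    have h2 := dist_triangle4 (g y) (k.1 y) (k.1 z) (g z)
    have h3 := hkg' y
    have h4 := hkg' z
    rw [dist_comm] at h3
    rw [hyz] at h1
    have : 0 < α * ε := by positivity
    linarith

/-- The supremum already equals 1 for every radius `r > 0`, so the limit superior is that of a
constant. -/
theorem localLip_eq_one {Y : Type*} [MetricSpace Y] {f : Y → Y}
    (hf : ∀ y z, dist (f y) (f z) ≤ dist y z) {y : Y}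
    (hy : ∀ m : ℕ, ∃ z, 0 < dist z y ∧ dist z y < 1 / ((m : ℝ) + 1) ∧
      (1 - 1 / ((m : ℝ) + 1)) * dist z y < dist (f z) (f y)) : localLip f y = 1 := by
  have key : ∀ r : ℝ, 0 < r → ⨆ z ∈ ball y r \ {y}, edist (f z) (f y) / edist z y = 1 := by
    intro r hr
    refine le_antisymm (iSup₂_le fun z hz => ?_) ?_
    · refine ENNReal.div_le_of_le_mul ?_
      rw [one_mul, edist_dist, edist_dist]
      exact ENNReal.ofReal_le_ofReal (hf z y)
    · refine le_of_forall_lt fun b hb => ?_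
      have hb' : b ≠ ⊤ := (hb.trans ENNReal.one_lt_top).ne
      have hb1 : b.toReal < 1 := by simpa using (ENNReal.toReal_lt_toReal hb' ENNReal.one_ne_top).2 hb
      obtain ⟨m, hm⟩ := exists_nat_one_div_lt (lt_min hr (sub_pos.2 hb1))
      obtain ⟨z, hz0, hzm, hz⟩ := hy m
      have hzr : z ∈ ball y r \ {y} :=
        ⟨mem_ball.2 (hzm.trans (hm.trans_le (min_le_left _ _))), dist_pos.1 hz0⟩
      refine lt_of_lt_of_le ?_
        (le_iSup₂ (f := fun z (_ : z ∈ ball y r \ {y}) => edist (f z) (f y) / edist z y) z hzr)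
      rw [edist_dist, edist_dist, ← ENNReal.ofReal_div_of_pos hz0, ENNReal.lt_ofReal_iff_toReal_lt hb',
        lt_div_iff₀ hz0]
      refine lt_of_le_of_lt (mul_le_mul_of_nonneg_right ?_ hz0.le) hz
      linarith [hm.trans_le (min_le_right _ _)]
  have hev : (fun r : ℝ => ⨆ z ∈ ball y r \ {y}, edist (f z) (f y) / edist z y) =ᶠ[𝓝[>] 0]
      fun _ => 1 := by
    filter_upwards [self_mem_nhdsWithin] with r hr using key r hr
  rw [localLip, limsup_congr hev, limsup_const]

/-- Every ball of a star contains points at a positive rational distance from the pole. -/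
theorem IsRadial.exists_rat_dist_pole {Y : Type*} [MetricSpace Y] {x : Y} {pos : Y → ℝ → Y}
    {S : ℝ → ℝ} {B : ℝ} (h : IsRadial x pos S B) {a₀ : Y} (ha₀ : a₀ ≠ x) (y : Y) {s : ℝ}
    (hs : 0 < s) : ∃ y₀ ∈ ball y s, ∃ q : ℚ, 0 < q ∧ dist y₀ x = q := by
  by_cases hy : y = x
  · obtain ⟨q, hq0, hq⟩ := exists_rat_btwn (lt_min hs (_root_.dist_pos.2 ha₀))
    have hqm : (q : ℝ) ∈ Icc 0 (dist a₀ x) := ⟨hq0.le, (hq.trans_le (min_le_right _ _)).le⟩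
    refine ⟨pos a₀ q, ?_, q, by exact_mod_cast hq0, h.dist_pos_pole a₀ hqm⟩
    rw [hy, mem_ball, h.dist_pos_pole a₀ hqm]
    exact hq.trans_le (min_le_left _ _)
  · have hyx : 0 < dist y x := _root_.dist_pos.2 hy
    obtain ⟨q, hq0, hq⟩ := exists_rat_btwn (max_lt (sub_lt_self (dist y x) hs) hyx)
    have hq1 : (0 : ℝ) < q := (le_max_right _ _).trans_lt hq0
    have hqm : (q : ℝ) ∈ Icc 0 (dist y x) := ⟨hq1.le, hq.le⟩
    refine ⟨pos y q, ?_, q, by exact_mod_cast hq1, h.dist_pos_pole y hqm⟩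
    rw [mem_ball, h.dist_pos_self y hqm]
    linarith [(le_max_left _ _).trans_lt hq0]

theorem IsRadial.lipOneSet_mem_residual {X : Type*} [MetricSpace X] {C : Set X} {x : C}
    {pos : C → ℝ → C} {S : ℝ → ℝ} {B : ℝ} (h : IsRadial x pos S B) {a₀ : C} (ha₀ : a₀ ≠ x)
    (f : NonexpansiveMap C) (hf : ∀ (n k : ℕ) (q : ℚ), 0 < q →
      f ∉ locallyContractiveMaps x B q (1 / ((k : ℝ) + 1)) (1 - 1 / ((n : ℝ) + 1))) :
    lipOneSet f ∈ residual C := by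
  have hf1 : ∀ y z, dist (f.1 y) (f.1 z) ≤ dist y z := fun y z => by
    simpa using f.2.dist_le_mul y z
  set U : ℕ → Set C := fun m => {y | ∃ z, 0 < dist z y ∧ dist z y < 1 / ((m : ℝ) + 1) ∧
      (1 - 1 / ((m : ℝ) + 1)) * dist z y < dist (f.1 z) (f.1 y)} with hU
  have hopen : ∀ m, IsOpen (U m) := by
    intro m
    have : U m = ⋃ z, {y | 0 < dist z y ∧ dist z y < 1 / ((m : ℝ) + 1) ∧
      (1 - 1 / ((m : ℝ) + 1)) * dist z y < dist (f.1 z) (f.1 y)} := by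
      ext y; simp [hU]
    rw [this]
    have hc := f.1.continuous
    refine isOpen_iUnion fun z => ?_
    have hd : Continuous fun y => dist z y := by fun_prop
    have hfd : Continuous fun y => dist (f.1 z) (f.1 y) := by fun_prop
    exact (isOpen_lt continuous_const hd).inter ((isOpen_lt hd continuous_const).inter
      (isOpen_lt (continuous_const.mul hd) hfd))
  have hdense : ∀ m, Dense (U m) := by
    intro m
    rw [Metric.dense_iff]
    intro y₁ s hs
    by_contra hcon
    obtain ⟨y₀, hy₀, q, hq0, hq⟩ := h.exists_rat_dist_pole ha₀ y₁ hs
    have hs' : 0 < s - dist y₀ y₁ := sub_pos.2 hy₀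
    have hm : 0 < 1 / ((m : ℝ) + 1) := Nat.one_div_pos_of_nat
    have hfy : 0 < B - dist (f.1 y₀) x := sub_pos.2 (h.dist_lt _)
    -- The radius `1 / (k + 1)` keeps the ball inside the given one, its diameter below `1 / (m +
    -- 1)`, and `f y₀` at the required distance below `B`.
    obtain ⟨k, hk⟩ := exists_nat_one_div_lt (lt_min hs' (lt_min (half_pos hm) (half_pos hfy)))
    have hk1 := hk.trans_le (min_le_left _ _)
    have hk2 := hk.trans_le ((min_le_right _ _).trans (min_le_left _ _))
    have hk3 := hk.trans_le ((min_le_right _ _).trans (min_le_right _ _))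
    refine hf m k q hq0 ⟨y₀, hq, by linarith, fun y hy z hz => ?_⟩
    by_contra! hlt
    refine hcon ⟨z, ?_, y, ?_, ?_, hlt⟩
    · rw [mem_ball] at hz ⊢
      linarith [dist_triangle z y₀ y₁]
    · refine _root_.dist_pos.2 ?_
      rintro rfl
      simp at hlt
    · rw [mem_ball] at hy hz
      linarith [dist_triangle_right y z y₀]
  refine mem_of_superset (countable_iInter_mem.2 fun m =>
    residual_of_dense_open (hopen m) (hdense m)) fun y hy => ?_
  exact localLip_eq_one hf1 fun m => mem_iInter.1 hy m

/-- For `κ > 0` the bound is `D_κ / 2`; for `κ ≤ 0` every positive bound is admissible, and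
boundedness of `C` supplies one. -/
theorem exists_isModelSine_of_bounded {X : Type*} [MetricSpace X] (κ : ℝ) {C : Set X}
    (hC_bdd : Bornology.IsBounded C) {x : X} (hC_ball : ∀ z ∈ C, edist z x < modelDiam κ / 2) :
    ∃ B, IsModelSine (curvSin κ) B ∧ ∀ z ∈ C, dist z x < B := by
  rcases lt_or_ge 0 κ with h | h
  · refine ⟨_, isModelSine_curvSin_of_pos h, fun z hz => ?_⟩
    have := hC_ball z hz
    rw [modelDiam, if_pos h, edist_dist, ← ENNReal.ofReal_ofNat 2,
      ← ENNReal.ofReal_div_of_pos two_pos] at this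
    exact (ENNReal.ofReal_lt_ofReal_iff_of_nonneg dist_nonneg).1 this
  · obtain ⟨R, hR⟩ := hC_bdd.subset_closedBall x
    refine ⟨max R 0 + 1, isModelSine_curvSin_of_nonpos h ?_, fun z hz => ?_⟩
    · linarith [le_max_right R 0]
    · linarith [mem_closedBall.1 (hR hz), le_max_left R 0]

theorem theorem2 {X : Type*} [MetricSpace X] (κ : ℝ) (hX : IsCATSpace κ X)
    (C : Set X) (hC_bdd : Bornology.IsBounded C) (hC_closed : IsClosed C)
    (hC_nontrivial : C.Nontrivial)
    (x : X) (hxC : x ∈ C) (hC_ball : ∀ z ∈ C, edist z x < modelDiam κ / 2)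
    (hC_star : ∀ z ∈ C, ∀ S : Set X, IsMetricSegment dist z x S → S ⊆ C) :
    ∃ P : Set (NonexpansiveMap C), IsSigmaPorous P ∧
      ∀ f : NonexpansiveMap C, f ∉ P → lipOneSet f ∈ residual C := by
  obtain ⟨B, hB, hCB⟩ := exists_isModelSine_of_bounded κ hC_bdd hC_ball
  obtain ⟨pos, h⟩ := hX.exists_isRadial ⟨x, hxC⟩ hB hCB hC_ball hC_star
  obtain ⟨a, haC, hax⟩ := hC_nontrivial.exists_ne x
  have ha₀ : (⟨a, haC⟩ : C) ≠ ⟨x, hxC⟩ := fun e => hax (congrArg Subtype.val e)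
  let Q : ℕ × ℕ × {q : ℚ // 0 < q} → Set (NonexpansiveMap C) := fun p =>
    locallyContractiveMaps ⟨x, hxC⟩ B p.2.2 (1 / ((p.2.1 : ℝ) + 1)) (1 - 1 / ((p.1 : ℝ) + 1))
  have : Nonempty {q : ℚ // 0 < q} := ⟨⟨1, one_pos⟩⟩
  obtain ⟨φ, hφ⟩ := exists_surjective_nat (ℕ × ℕ × {q : ℚ // 0 < q})
  refine ⟨⋃ n, Q (φ n), ⟨fun n => Q (φ n), fun n => ?_, rfl⟩, fun f hf => ?_⟩
  · refine h.isPorous_locallyContractiveMaps ha₀ (by exact_mod_cast (φ n).2.2.2)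
      Nat.one_div_pos_of_nat ?_
    linarith [Nat.one_div_pos_of_nat (α := ℝ) (n := (φ n).1)]
  · refine h.lipOneSet_mem_residual ha₀ f fun n k q hq hmem => hf ?_
    obtain ⟨i, hi⟩ := hφ (n, k, ⟨q, hq⟩)
    refine mem_iUnion.2 ⟨i, ?_⟩
    rw [hi]
    exact hmem
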